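/- Let $K=\mathbb{Q}(i)\subset\mathbb{C}$ and $\mathcal{O}=\mathbb{Z}[i]$. Put $\varpi=2\int_0^1\frac{dt}{\sqrt{1-t^4}}$ and let $\varphi$ be the lemniscatic function: on $[-\varpi/2,\varpi/2]$ it is the inverse of $r\mapsto\int_0^r\frac{dt}{\sqrt{1-t^4}}$ $(-1\le r\le 1)$; it extends to $\mathbb{R}$ by $\varphi(s+\varpi)=-\varphi(s)$ (so it has period $2\varpi$) and to $\mathbb{C}$ by $$\varphi(x+iy)=\frac{\varphi(x)\varphi'(y)+i\,\varphi(y)\varphi'(x)}{1-\varphi(x)^2\varphi(y)^2}\qquad(x,y\in\mathbb{R}).$$ Let $L=\mathbb{Z}(1+i)\varpi+\mathbb{Z}(1-i)\varpi$ be the period lattice of $\varphi$, an $\mathcal{O}$-submodule of $\mathbb{C}$, let $\wp(z)=\wp(z;L)$ be its Weierstrass function, and let $E=\mathbb{C}/L$, with coordinates $X=\wp(z)$, $Y=\wp'(z)$ of the point $[z]\ne 0$. The Weierstrass equation $Y^2=4X^3-g_2(L)X-g_3(L)$ of $E$ is $Y^2=4X^3+X$, i.e. $g_2(L)=-1$ and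 $g_3(L)=0$. Moreover, let $\beta\in\mathcal{O}$ be odd, i.e. relatively prime to $1+i$, and let $\delta\in\mathbb{C}$ be any $\beta$-torsion generator, i.e. $\delta\in\frac1\beta L$ and the class of $\delta$ generates the $\mathcal{O}$-module $\frac1\beta L/L$. Put $K_\beta=K(\varphi(\frac{2\varpi}{\beta}))$. Then $$K_\beta=K(\varphi(\delta))=K(\varphi(\delta),\varphi'(\delta))=K(\wp(\delta),\wp'(\delta))=K(E[\beta]),$$ where $E[\beta]=\frac1\beta L/L$ is the group of $\beta$-torsion points of $E$ and $K(E[\beta])$ is the field obtained from $K$ by adjoining the coordinates $\wp(z),\wp'(z)$ of all points $[z]\ne 0$ of $E[\beta]$. (If $\beta$ is a unit, then $\delta\in L$ is a pole of $\wp$ and $[\delta]$ is the point at infinity, which has no coordinates; in this case $K(\wp(\delta),\wp'(\delta))$ means $K$.) -/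

import Mathlib

namespace Lemniscate

open Complex

/-- The arc length `∫₀ʳ dt / √(1 - t⁴)` of the lemniscate, for `r ∈ [-1, 1]` (negative for
`r < 0`). -/
noncomputable def arcLength (r : ℝ) : ℝ := ∫ t in (0 : ℝ)..r, 1 / √(1 - t ^ 4)

/-- The lemniscate constant `ϖ`: `ϖ / 2 = ∫₀¹ dt / √(1 - t⁴)`. -/
noncomputable def varpi : ℝ := 2 * arcLength 1

/-- The inverse function `[-ϖ/2, ϖ/2] → [-1, 1]` of the arc length. -/
noncomputable def arcLengthInv (s : ℝ) : ℝ := Function.invFunOn arcLength (Set.Icc (-1) 1) s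

/-- Abel's lemniscatic function on `ℝ`: the inverse of the arc length on `[-ϖ/2, ϖ/2]`, continued
along the lemniscate by `φ (s + ϖ) = - φ s` (so that it has period `2ϖ`). Here
`n = round (s / ϖ)` is the integer with `s - n ϖ ∈ [-ϖ/2, ϖ/2)`. -/
noncomputable def phiReal (s : ℝ) : ℝ :=
  (-1) ^ round (s / varpi) * arcLengthInv (s - round (s / varpi) * varpi)

/-- The complex lemniscatic function
`φ (x + i y) = (φ x φ' y + i φ y φ' x) / (1 - (φ x)² (φ y)²)`. The denominator vanishes exactly
at the poles of `φ`. -/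
noncomputable def phi (z : ℂ) : ℂ :=
  ((phiReal z.re : ℂ) * (deriv phiReal z.im : ℝ) + I * (phiReal z.im : ℂ) * (deriv phiReal z.re : ℝ)) /
    (1 - (phiReal z.re : ℂ) ^ 2 * (phiReal z.im : ℂ) ^ 2)

theorem varpi_pos : 0 < varpi := by
  have hint : IntervalIntegrable (fun t : ℝ => 1 / √(1 - t ^ 4)) MeasureTheory.volume 0 1 := by
    have h1 : IntervalIntegrable (fun t : ℝ => (1 - t) ^ (-(1 / 2) : ℝ))
        MeasureTheory.volume 0 1 := by
      have h := (intervalIntegral.intervalIntegrable_rpow' (a := 1) (b := 0)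
        (r := (-(1 / 2) : ℝ)) (by norm_num)).comp_sub_left 1
      simpa using h
    refine h1.mono_fun ?_ ?_
    · exact (by fun_prop : Measurable fun t : ℝ => 1 / √(1 - t ^ 4)).aestronglyMeasurable
    · refine (MeasureTheory.ae_restrict_iff' measurableSet_uIoc).2 (.of_forall fun t ht => ?_)
      rw [Set.uIoc_of_le zero_le_one] at ht
      obtain ⟨h0, h1⟩ := ht
      have h4 : t ^ 4 ≤ t := by
        simpa using pow_le_pow_of_le_one h0.le h1 (show 1 ≤ 4 by norm_num)
      rcases h1.eq_or_lt with rfl | h1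
      · simp
      beta_reduce
      rw [Real.rpow_neg (by linarith), ← Real.sqrt_eq_rpow, ← one_div,
        Real.norm_of_nonneg (by positivity), Real.norm_of_nonneg (by positivity)]
      exact one_div_le_one_div_of_le (Real.sqrt_pos.2 (by linarith))
        (Real.sqrt_le_sqrt (by linarith))
  have := intervalIntegral.intervalIntegral_pos_of_pos_on hint (fun t ht => by
    have : t ^ 4 < 1 := pow_lt_one₀ ht.1.le ht.2 (by norm_num)
    have : 0 < √(1 - t ^ 4) := Real.sqrt_pos.2 (by linarith)
    positivity) zero_lt_one
  unfold varpi arcLength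
  linarith

/-- The periods `(1 + i) ϖ` and `(1 - i) ϖ` of `φ`. -/
noncomputable def periods : PeriodPair where
  ω₁ := (1 + I) * varpi
  ω₂ := (1 - I) * varpi
  indep := by
    have := varpi_pos.ne'
    rw [LinearIndependent.pair_iff]
    intro s t h
    have h1 := congrArg re h
    have h2 := congrArg im h
    simp at h1 h2
    have e1 : (s + t) * varpi = 0 := by linarith
    have e2 : (s - t) * varpi = 0 := by linarith
    simp only [mul_eq_zero, this, or_false] at e1 e2
    constructor <;> linarith

/-- `ℂ` as a module over the Gaussian integers, acting by multiplication. -/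
noncomputable instance : Module GaussianInt ℂ := Module.compHom ℂ GaussianInt.toComplex

theorem smul_def (a : GaussianInt) (z : ℂ) : a • z = (a : ℂ) * z := rfl

/-- The period lattice `L = ℤ (1 + i) ϖ + ℤ (1 - i) ϖ`, with its structure of `ℤ[i]`-module. -/
noncomputable def L : Submodule GaussianInt ℂ where
  carrier := periods.lattice
  add_mem' := add_mem
  zero_mem' := zero_mem _
  smul_mem' a z hz := by
    simp only [SetLike.mem_coe, PeriodPair.mem_lattice] at hz ⊢
    obtain ⟨m, n, rfl⟩ := hz
    refine ⟨a.re * m + a.im * n, a.re * n - a.im * m, ?_⟩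
    rw [smul_def, GaussianInt.toComplex_def]
    simp only [periods]
    push_cast
    linear_combination (m - n) * (a.im : ℂ) * varpi * (-I_sq)

/-- The elliptic curve `E = ℂ / L`, with its complex multiplication by `ℤ[i]`. -/
abbrev E : Type := ℂ ⧸ L

/-- `β ∈ ℤ[i]` is odd if it is relatively prime to `1 + i`. -/
def IsOdd (β : GaussianInt) : Prop := IsCoprime β (⟨1, 1⟩ : GaussianInt)

/-- The `β`-torsion `E[β] = (1/β) L / L` of `E`. -/
noncomputable abbrev torsion (β : GaussianInt) : Submodule GaussianInt E :=
  Submodule.torsionBy GaussianInt E β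

/-- `δ ∈ (1/β) L` is a `β`-torsion generator if its class generates `(1/β) L / L` as a
`ℤ[i]`-module. -/
def IsTorsionGenerator (β : GaussianInt) (δ : ℂ) : Prop :=
  Submodule.span GaussianInt {(L.mkQ δ : E)} = torsion β

/-- The field `K = ℚ(i)`, as a subfield of `ℂ`. -/
noncomputable abbrev K : IntermediateField ℚ ℂ := IntermediateField.adjoin ℚ {I}

/-- The Weierstrass function `℘ (z) = ℘ (z; L)`. -/
noncomputable abbrev wp (z : ℂ) : ℂ := periods.weierstrassP z

/-- The derivative `℘'` of the Weierstrass function of `L`. -/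
noncomputable abbrev wp' (z : ℂ) : ℂ := periods.derivWeierstrassP z

/-- The field `K_β = K(φ(2ϖ/β))`. -/
noncomputable def fieldK (β : GaussianInt) : IntermediateField K ℂ :=
  IntermediateField.adjoin K {phi (2 * varpi / (β : ℂ))}

/-- The coordinates of the `β`-torsion points of `E`: the point `z mod L`, other than the point
at infinity `0 mod L`, has the coordinates `X = ℘ z`, `Y = ℘' z`. -/
def torsionCoords (β : GaussianInt) : Set ℂ :=
  {w | ∃ z : ℂ, (L.mkQ z : E) ≠ 0 ∧ L.mkQ z ∈ torsion β ∧ (w = wp z ∨ w = wp' z)}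

/-- The field `K(E[β])`, obtained from `K` by adjoining the coordinates of the `β`-torsion
points of `E`. -/
noncomputable def torsionField (β : GaussianInt) : IntermediateField K ℂ :=
  IntermediateField.adjoin K (torsionCoords β)

end Lemniscate

namespace Lemniscate

open Complex Filter Topology

/-! The analytic input is that φ is meromorphic with φ'² = 1 - φ⁴ (`deriv_phi_sq`), has simple zeros
on ℤ[i]ϖ, and satisfies φ(iz) = iφ(z) and Euler's addition formula (`phi_add`).

To reach ℘, consider ℘' + 2℘/φ. It is L-periodic, its singularities at 0 and ϖ cancel, and Liouville
gives ℘' = -2℘/φ (`wp'_eq`). Since g₃ = 0 by the symmetry z ↦ iz, the Weierstrass equation becomes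
φ²(4℘² - g₂) = 4℘. Differentiating yields 1 + φ' = 2φ²℘ (`one_add_deriv_phi`), and comparison with
φ'² = 1 - φ⁴ forces g₂ = -1. So (φ, φ') and (℘, ℘') are rational in each other at torsion points
outside L.

For the fields, let φ(δ) ∈ F and c = φ'(δ), so c² ∈ F. The formula for φ(z + w) + φ(z - w) with w =
δ or iδ is a recurrence showing that φ((a + bi)δ) lies in F when a + b is odd, and in cF when a + b
is even (`parityMem_phi_mul`). Since β is odd and βδ is a period, adding β to the multiplier flips
the parity but keeps the value. Hence φ((1 + i)δ) ∈ F, and φ((1 + i)δ)φ'(δ) = (1 + i)φ(δ) gives c ∈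
F (`deriv_phi_mem`). Then F contains φ at every β-torsion point; as 2ϖ/β is also a generator, all
the fields coincide. -/

/-! ### The arc length and its inverse -/

theorem intervalIntegrable_one_div_sqrt :
    IntervalIntegrable (fun t : ℝ => 1 / √(1 - t ^ 4)) MeasureTheory.volume (-1) 1 := by
  have h01 : IntervalIntegrable (fun t : ℝ => 1 / √(1 - t ^ 4)) MeasureTheory.volume 0 1 := by
    by_contra h
    have := varpi_pos
    rw [varpi, arcLength, intervalIntegral.integral_undef h] at this
    simp at this
  have h10 := IntervalIntegrable.comp_sub_left h01 0
  simp only [zero_sub, neg_zero, Even.neg_pow (show Even 4 by decide)] at h10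
  exact h10.symm.trans h01

theorem intervalIntegrable_one_div_sqrt' {a b : ℝ} (ha : a ∈ Set.Icc (-1 : ℝ) 1)
    (hb : b ∈ Set.Icc (-1 : ℝ) 1) :
    IntervalIntegrable (fun t : ℝ => 1 / √(1 - t ^ 4)) MeasureTheory.volume a b := by
  refine intervalIntegrable_one_div_sqrt.mono_set ?_
  rw [Set.uIcc_of_le (show (-1 : ℝ) ≤ 1 by norm_num)]
  exact Set.uIcc_subset_Icc ha hb

theorem pow_four_lt_one {r : ℝ} (hr : r ∈ Set.Ioo (-1 : ℝ) 1) : r ^ 4 < 1 := by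
  have h : r ^ 2 < 1 := by nlinarith [hr.1, hr.2]
  nlinarith [sq_nonneg r]

theorem arcLength_neg (r : ℝ) : arcLength (-r) = -arcLength r := by
  unfold arcLength
  have := intervalIntegral.integral_comp_neg (fun t : ℝ => 1 / √(1 - t ^ 4)) (a := 0) (b := r)
  rw [neg_zero, intervalIntegral.integral_symm 0 (-r)] at this
  rw [← neg_eq_iff_eq_neg, ← this]
  simp [Even.neg_pow (show Even 4 by decide)]

theorem continuousOn_arcLength : ContinuousOn arcLength (Set.Icc (-1) 1) := by
  have h := intervalIntegral.continuousOn_primitive_interval' (a := 0)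
    intervalIntegrable_one_div_sqrt (by simp)
  rwa [Set.uIcc_of_le (show (-1 : ℝ) ≤ 1 by norm_num)] at h

theorem hasDerivAt_arcLength {r : ℝ} (hr : r ∈ Set.Ioo (-1 : ℝ) 1) :
    HasDerivAt arcLength (1 / √(1 - r ^ 4)) r := by
  have h := pow_four_lt_one hr
  refine intervalIntegral.integral_hasDerivAt_right
    (intervalIntegrable_one_div_sqrt' (by simp) (Set.Ioo_subset_Icc_self hr)) ?_ ?_
  · exact (by fun_prop : Measurable fun t : ℝ => 1 / √(1 - t ^ 4)).stronglyMeasurable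
      |>.stronglyMeasurableAtFilter
  · refine ContinuousAt.div continuousAt_const (by fun_prop) (Real.sqrt_pos.2 (by linarith)).ne'

theorem strictMonoOn_arcLength : StrictMonoOn arcLength (Set.Icc (-1) 1) := by
  refine strictMonoOn_of_deriv_pos (convex_Icc _ _) continuousOn_arcLength fun r hr => ?_
  rw [interior_Icc] at hr
  rw [(hasDerivAt_arcLength hr).deriv]
  have := pow_four_lt_one hr
  have : 0 < √(1 - r ^ 4) := Real.sqrt_pos.2 (by linarith)
  positivity

theorem arcLength_one : arcLength 1 = varpi / 2 := by simp [varpi]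

theorem arcLength_neg_one : arcLength (-1) = -(varpi / 2) := by
  rw [arcLength_neg, arcLength_one]

theorem image_arcLength :
    arcLength '' Set.Icc (-1) 1 = Set.Icc (-(varpi / 2)) (varpi / 2) := by
  rw [← arcLength_one, ← arcLength_neg]
  refine Set.Subset.antisymm ?_ (intermediate_value_Icc (by norm_num) continuousOn_arcLength)
  rintro _ ⟨r, hr, rfl⟩
  exact ⟨strictMonoOn_arcLength.monotoneOn (by simp) hr hr.1,
    strictMonoOn_arcLength.monotoneOn hr (by simp) hr.2⟩

theorem arcLengthInv_mem {s : ℝ} (hs : s ∈ Set.Icc (-(varpi / 2)) (varpi / 2)) :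
    arcLengthInv s ∈ Set.Icc (-1 : ℝ) 1 :=
  Function.invFunOn_mem (by rwa [← image_arcLength] at hs)

theorem arcLength_arcLengthInv {s : ℝ} (hs : s ∈ Set.Icc (-(varpi / 2)) (varpi / 2)) :
    arcLength (arcLengthInv s) = s :=
  Function.invFunOn_eq (by rwa [← image_arcLength] at hs)

theorem arcLengthInv_arcLength {r : ℝ} (hr : r ∈ Set.Icc (-1 : ℝ) 1) :
    arcLengthInv (arcLength r) = r :=
  strictMonoOn_arcLength.injOn.leftInvOn_invFunOn hr

theorem arcLengthInv_neg {s : ℝ} (hs : s ∈ Set.Icc (-(varpi / 2)) (varpi / 2)) :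
    arcLengthInv (-s) = -arcLengthInv s := by
  have h := arcLengthInv_mem hs
  conv_lhs => rw [← arcLength_arcLengthInv hs, ← arcLength_neg]
  exact arcLengthInv_arcLength ⟨by linarith [h.2], by linarith [h.1]⟩

theorem continuousOn_arcLengthInv :
    ContinuousOn arcLengthInv (Set.Icc (-(varpi / 2)) (varpi / 2)) := by
  rw [continuousOn_iff_isClosed]
  intro t ht
  refine ⟨arcLength '' (t ∩ Set.Icc (-1) 1), ?_, ?_⟩
  · exact ((isCompact_Icc.inter_left ht).image_of_continuousOn
      (continuousOn_arcLength.mono Set.inter_subset_right)).isClosed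
  · ext s
    constructor
    · rintro ⟨h1, h2⟩
      exact ⟨⟨_, ⟨h1, arcLengthInv_mem h2⟩, arcLength_arcLengthInv h2⟩, h2⟩
    · rintro ⟨⟨r, ⟨h1, h2⟩, rfl⟩, h3⟩
      refine ⟨?_, h3⟩
      rwa [Set.mem_preimage, arcLengthInv_arcLength h2]

theorem arcLengthInv_mem_Ioo {s : ℝ} (hs : s ∈ Set.Ioo (-(varpi / 2)) (varpi / 2)) :
    arcLengthInv s ∈ Set.Ioo (-1 : ℝ) 1 := by
  have h1 := arcLengthInv_mem (Set.Ioo_subset_Icc_self hs)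
  have h2 := arcLength_arcLengthInv (Set.Ioo_subset_Icc_self hs)
  refine ⟨lt_of_le_of_ne h1.1 fun h => ?_, lt_of_le_of_ne h1.2 fun h => ?_⟩
  · rw [← h, arcLength_neg_one] at h2
    exact hs.1.ne h2
  · rw [h, arcLength_one] at h2
    exact hs.2.ne' h2

theorem hasDerivAt_arcLengthInv {s : ℝ} (hs : s ∈ Set.Ioo (-(varpi / 2)) (varpi / 2)) :
    HasDerivAt arcLengthInv (√(1 - arcLengthInv s ^ 4)) s := by
  have h1 := arcLengthInv_mem_Ioo hs
  have h2 := pow_four_lt_one h1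
  have h3 : √(1 - arcLengthInv s ^ 4) ≠ 0 := (Real.sqrt_pos.2 (by linarith)).ne'
  have := (hasDerivAt_arcLength h1).of_local_left_inverse
    (continuousOn_arcLengthInv.continuousAt (Icc_mem_nhds hs.1 hs.2)) (by positivity) (by
      filter_upwards [Icc_mem_nhds hs.1 hs.2] with t ht using arcLength_arcLengthInv ht)
  simpa using this

/-! ### Gluing antiperiodic functions -/

theorem exists_sub_round_mul_mem {p : ℝ} (hp : 0 < p) (s : ℝ) :
    s - round (s / p) * p ∈ Set.Ico (-(p / 2)) (p / 2) := by
  have h1 := round_le_add_half (s / p)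
  have h2 := sub_half_lt_round (s / p)
  have e : s = s / p * p := by field_simp
  constructor
  · nlinarith
  · nlinarith

theorem _root_.Function.Antiperiodic.neg_one_zpow_mul {f : ℝ → ℝ} {p : ℝ}
    (hf : Function.Antiperiodic f p) (n : ℤ) (x : ℝ) : (-1 : ℝ) ^ n * f (x + n * p) = f x := by
  rw [hf.add_int_mul_eq]
  rcases Int.even_or_odd n with h | h
  · simp [Int.negOnePow_even _ h, h.neg_one_zpow]
  · simp [Int.negOnePow_odd _ h, h.neg_one_zpow]

/-- Gluing one translate onto the fundamental interval makes the endpoint p/2 interior; every point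
is then moved into (-p/2, p/2]. -/
theorem _root_.Function.Antiperiodic.continuous_of_continuousOn {f : ℝ → ℝ} {p : ℝ} (hp : 0 < p)
    (hf : Function.Antiperiodic f p) (hc : ContinuousOn f (Set.Icc (-(p / 2)) (p / 2))) :
    Continuous f := by
  have h2 : ContinuousOn f (Set.Icc (p / 2) (3 * p / 2)) := by
    have : ContinuousOn (fun x => -f (x - p)) (Set.Icc (p / 2) (3 * p / 2)) :=
      (hc.comp (by fun_prop) fun x hx => ⟨by linarith [hx.1], by linarith [hx.2]⟩).neg
    refine this.congr fun x _ => ?_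
    simp [hf.sub_eq]
  have h3 : ContinuousOn f (Set.Icc (-(p / 2)) (3 * p / 2)) := by
    rw [← Set.Icc_union_Icc_eq_Icc (b := p / 2) (by linarith) (by linarith)]
    exact hc.union_of_isClosed h2 isClosed_Icc isClosed_Icc
  have h4 : ∀ x ∈ Set.Ioc (-(p / 2)) (p / 2), ContinuousAt f x := fun x hx =>
    h3.continuousAt (Icc_mem_nhds hx.1 (by linarith [hx.2]))
  rw [continuous_iff_continuousAt]
  intro s
  -- Rounding -s instead of s exchanges the closed and the open end of the interval, as `h4`
  -- requires.
  set n : ℤ := round (-s / p)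
  have h5 : -s - n * p ∈ Set.Ico (-(p / 2)) (p / 2) := exists_sub_round_mul_mem hp (-s)
  have h6 : ContinuousAt (fun x => (-1 : ℝ) ^ n * f (x + n * p)) s := by
    refine ContinuousAt.const_mul (ContinuousAt.comp (f := fun x => x + n * p) (h4 _ ?_)
      (Continuous.continuousAt (by fun_prop))) _
    exact ⟨by linarith [h5.2], by linarith [h5.1]⟩
  exact h6.congr (.of_forall fun x => hf.neg_one_zpow_mul n x)

/-- The derivative is known off the countable set of nodes, so f is a primitive of the continuous g;
the nodes then follow from the fundamental theorem of calculus. -/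
theorem _root_.Function.Antiperiodic.hasDerivAt_of_Ioo {f g : ℝ → ℝ} {p : ℝ} (hp : 0 < p)
    (hf : Function.Antiperiodic f p) (hg : Function.Antiperiodic g p)
    (hcf : Continuous f) (hcg : Continuous g)
    (h : ∀ s ∈ Set.Ioo (-(p / 2)) (p / 2), HasDerivAt f (g s) s) (s : ℝ) :
    HasDerivAt f (g s) s := by
  have key : ∀ x ∉ Set.range fun n : ℤ => n * p - p / 2, HasDerivAt f (g x) x := by
    intro x hx
    set n : ℤ := round (x / p)
    have h5 : x - n * p ∈ Set.Ico (-(p / 2)) (p / 2) := exists_sub_round_mul_mem hp x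
    have h6 : x - n * p ∈ Set.Ioo (-(p / 2)) (p / 2) :=
      ⟨lt_of_le_of_ne h5.1 fun e => hx ⟨n, by dsimp only; linarith⟩, h5.2⟩
    have h7 : HasDerivAt (fun y => f (y - n * p)) (g (x - n * p)) x :=
      (h _ h6).comp_sub_const x (n * p)
    have h8 := h7.const_mul ((-1 : ℝ) ^ (-n))
    have e : ∀ {f : ℝ → ℝ}, Function.Antiperiodic f p → ∀ y, (-1 : ℝ) ^ (-n) * f (y - n * p) = f y := by
      intro f hf y
      rw [← hf.neg_one_zpow_mul (-n) y]
      push_cast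
      ring_nf
    simpa only [e hf, e hg] using h8
  have int : ∀ x, f x = f 0 + ∫ t in (0 : ℝ)..x, g t := fun x => by
    rw [MeasureTheory.integral_eq_of_hasDerivAt_off_countable f g (Set.countable_range _)
      hcf.continuousOn (fun x hx => key x hx.2) (hcg.intervalIntegrable _ _)]
    ring
  have := (intervalIntegral.integral_hasDerivAt_right (hcg.intervalIntegrable 0 s)
    hcg.stronglyMeasurable.stronglyMeasurableAtFilter hcg.continuousAt).const_add (f 0)
  exact this.congr_of_eventuallyEq (.of_forall int)

/-! ### The real lemniscatic function -/

theorem antiperiodic_phiReal : Function.Antiperiodic phiReal varpi := by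
  intro s
  have h : (s + varpi) / varpi = s / varpi + 1 := by field_simp [varpi_pos.ne']
  have e : s + varpi - (round (s / varpi) + 1) * varpi = s - round (s / varpi) * varpi := by ring
  simp only [phiReal, h, round_add_one, Int.cast_add, Int.cast_one, e]
  rw [zpow_add₀ (by norm_num)]
  ring

theorem phiReal_eq_arcLengthInv {s : ℝ} (hs : s ∈ Set.Icc (-(varpi / 2)) (varpi / 2)) :
    phiReal s = arcLengthInv s := by
  have key : ∀ t ∈ Set.Ico (-(varpi / 2)) (varpi / 2), phiReal t = arcLengthInv t := by
    intro t ht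
    have : round (t / varpi) = 0 := by
      rw [round_eq, Int.floor_eq_zero_iff]
      have e : t = t / varpi * varpi := by field_simp [varpi_pos.ne']
      constructor <;> nlinarith [ht.1, ht.2, varpi_pos]
    simp [phiReal, this]
  -- The endpoint ϖ/2 does not round to 0, so its value is obtained from -ϖ/2 by antiperiodicity.
  rcases hs.2.eq_or_lt with rfl | h
  · have h1 := antiperiodic_phiReal (-(varpi / 2))
    have h2 : -(varpi / 2) ∈ Set.Ico (-(varpi / 2)) (varpi / 2) := ⟨le_rfl, by linarith [varpi_pos]⟩
    rw [key _ h2, arcLengthInv_neg ⟨by linarith [varpi_pos], le_rfl⟩] at h1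
    simpa [show -(varpi / 2) + varpi = varpi / 2 by ring] using h1
  · exact key s ⟨hs.1, h⟩

/-- The derivative of `phiReal`. -/
noncomputable def phiReal' (s : ℝ) : ℝ := (-1) ^ round (s / varpi) * √(1 - phiReal s ^ 4)

theorem antiperiodic_phiReal' : Function.Antiperiodic phiReal' varpi := by
  intro s
  have h : (s + varpi) / varpi = s / varpi + 1 := by field_simp [varpi_pos.ne']
  simp only [phiReal', h, round_add_one, antiperiodic_phiReal s,
    Even.neg_pow (show Even 4 by decide)]
  rw [zpow_add₀ (by norm_num)]
  ring

theorem phiReal_mem_Icc (s : ℝ) : phiReal s ∈ Set.Icc (-1 : ℝ) 1 := by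
  have h := exists_sub_round_mul_mem varpi_pos s
  have h1 := arcLengthInv_mem ⟨h.1, h.2.le⟩
  unfold phiReal
  rcases Int.even_or_odd (round (s / varpi)) with h | h
  · simpa [h.neg_one_zpow] using h1
  · rw [h.neg_one_zpow]
    exact ⟨by linarith [h1.2], by linarith [h1.1]⟩

theorem phiReal_pow_four_le (s : ℝ) : phiReal s ^ 4 ≤ 1 := by
  have h := phiReal_mem_Icc s
  have : phiReal s ^ 2 ≤ 1 := by nlinarith [h.1, h.2]
  nlinarith [sq_nonneg (phiReal s)]

theorem phiReal'_sq (s : ℝ) : phiReal' s ^ 2 = 1 - phiReal s ^ 4 := by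
  rw [phiReal', mul_pow, Real.sq_sqrt (by linarith [phiReal_pow_four_le s]), ← zpow_natCast,
    ← zpow_mul, Even.neg_one_zpow (by simp), one_mul]

theorem arcLengthInv_half_varpi : arcLengthInv (varpi / 2) = 1 := by
  rw [← arcLength_one, arcLengthInv_arcLength (by simp)]

theorem phiReal'_eq {s : ℝ} (hs : s ∈ Set.Icc (-(varpi / 2)) (varpi / 2)) :
    phiReal' s = √(1 - phiReal s ^ 4) := by
  rcases hs.2.eq_or_lt with rfl | h
  · simp [phiReal', phiReal_eq_arcLengthInv hs, arcLengthInv_half_varpi]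
  · have : round (s / varpi) = 0 := by
      rw [round_eq, Int.floor_eq_zero_iff]
      have e : s = s / varpi * varpi := by field_simp [varpi_pos.ne']
      constructor <;> nlinarith [hs.1, varpi_pos]
    simp [phiReal', this]

theorem continuous_phiReal : Continuous phiReal :=
  antiperiodic_phiReal.continuous_of_continuousOn varpi_pos
    (continuousOn_arcLengthInv.congr fun _ hs => phiReal_eq_arcLengthInv hs)

theorem continuous_phiReal' : Continuous phiReal' :=
  antiperiodic_phiReal'.continuous_of_continuousOn varpi_pos
    (ContinuousOn.congr (by have := continuous_phiReal; fun_prop) fun _ hs => phiReal'_eq hs)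

theorem hasDerivAt_phiReal (s : ℝ) : HasDerivAt phiReal (phiReal' s) s := by
  refine antiperiodic_phiReal.hasDerivAt_of_Ioo varpi_pos antiperiodic_phiReal'
    continuous_phiReal continuous_phiReal' (fun s hs => ?_) s
  have hs' := Set.Ioo_subset_Icc_self hs
  rw [phiReal'_eq hs', phiReal_eq_arcLengthInv hs']
  refine (hasDerivAt_arcLengthInv hs).congr_of_eventuallyEq ?_
  filter_upwards [Icc_mem_nhds hs.1 hs.2] with t ht using phiReal_eq_arcLengthInv ht

theorem hasDerivAt_phiReal' (s : ℝ) : HasDerivAt phiReal' (-2 * phiReal s ^ 3) s := by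
  refine antiperiodic_phiReal'.hasDerivAt_of_Ioo (g := fun s => -2 * phiReal s ^ 3) varpi_pos
    (fun s => ?_) continuous_phiReal' (by have := continuous_phiReal; fun_prop) (fun s hs => ?_) s
  · simp only [antiperiodic_phiReal s]
    ring
  have hs' := Set.Ioo_subset_Icc_self hs
  have h1 := pow_four_lt_one (arcLengthInv_mem_Ioo hs)
  rw [← phiReal_eq_arcLengthInv hs'] at h1
  have h2 := (((hasDerivAt_phiReal s).pow 4).const_sub 1).sqrt (by simp; linarith)
  have h3 : √(1 - phiReal s ^ 4) ≠ 0 := (Real.sqrt_pos.2 (by linarith)).ne'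
  rw [phiReal'_eq hs'] at h2
  refine (h2.congr_of_eventuallyEq ?_).congr_deriv ?_
  · filter_upwards [Icc_mem_nhds hs.1 hs.2] with t ht
    simp [phiReal'_eq ht]
  · simp
    field_simp
    ring

theorem deriv_phiReal : deriv phiReal = phiReal' :=
  funext fun s => (hasDerivAt_phiReal s).deriv

theorem phiReal_neg (s : ℝ) : phiReal (-s) = -phiReal s := by
  have h := exists_sub_round_mul_mem varpi_pos s
  set n := round (s / varpi)
  have h1 := antiperiodic_phiReal.neg_one_zpow_mul (-n) s
  have h2 := antiperiodic_phiReal.neg_one_zpow_mul n (-s)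
  have e1 : s + ((-n : ℤ) : ℝ) * varpi = s - n * varpi := by push_cast; ring
  have e2 : -s + n * varpi = -(s - n * varpi) := by ring
  rw [e1] at h1
  rw [e2, phiReal_eq_arcLengthInv ⟨by linarith [h.2], by linarith [h.1]⟩,
    arcLengthInv_neg ⟨h.1, h.2.le⟩, ← phiReal_eq_arcLengthInv ⟨h.1, h.2.le⟩] at h2
  have e3 : ((-1 : ℝ) ^ (-n)) = (-1) ^ n := by simp [zpow_neg, ← inv_zpow]
  rw [← h2, ← h1, e3]
  ring

theorem phiReal'_neg (s : ℝ) : phiReal' (-s) = phiReal' s := by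
  have h1 : HasDerivAt (fun x => -phiReal (-x)) (phiReal' (-s)) s :=
    (((hasDerivAt_phiReal (-s)).comp s (hasDerivAt_neg s)).neg).congr_deriv (by simp)
  have h2 : (fun x => -phiReal (-x)) = phiReal := funext fun x => by simp [phiReal_neg]
  rw [h2] at h1
  exact h1.unique (hasDerivAt_phiReal s)

theorem phiReal_zero : phiReal 0 = 0 := by
  have := phiReal_neg 0
  rw [neg_zero] at this
  linarith

theorem phiReal'_zero : phiReal' 0 = 1 := by
  simp [phiReal', phiReal_zero]

theorem phiReal_half_varpi : phiReal (varpi / 2) = 1 := by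
  rw [phiReal_eq_arcLengthInv ⟨by linarith [varpi_pos], le_rfl⟩, arcLengthInv_half_varpi]

theorem phiReal'_half_varpi : phiReal' (varpi / 2) = 0 := by
  have := phiReal'_sq (varpi / 2)
  simpa [phiReal_half_varpi] using this

theorem arcLength_zero : arcLength 0 = 0 := by simp [arcLength]

theorem phiReal_eq_zero_iff {s : ℝ} : phiReal s = 0 ↔ ∃ n : ℤ, s = n * varpi := by
  constructor
  · intro h0
    have h := exists_sub_round_mul_mem varpi_pos s
    refine ⟨round (s / varpi), ?_⟩
    have h1 : arcLengthInv (s - round (s / varpi) * varpi) = 0 := by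
      simpa [phiReal, zpow_ne_zero] using h0
    have h2 := arcLength_arcLengthInv ⟨h.1, h.2.le⟩
    rw [h1, arcLength_zero] at h2
    linarith
  · rintro ⟨n, rfl⟩
    have := antiperiodic_phiReal.neg_one_zpow_mul n 0
    simpa [phiReal_zero, zpow_ne_zero] using this

/-- Euler's argument: with k = x + y fixed, the quotient formed from t and k - t has derivative 0,
so its values at t = x and t = 0 agree. -/
theorem phiReal_add (x y : ℝ) :
    (1 + phiReal x ^ 2 * phiReal y ^ 2) * phiReal (x + y) =
      phiReal x * phiReal' y + phiReal y * phiReal' x := by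
  set k := x + y with hk
  have hden : ∀ t, 1 + phiReal t ^ 2 * phiReal (k - t) ^ 2 ≠ 0 := fun t => by positivity
  have hder : ∀ t, HasDerivAt (fun t => (phiReal t * phiReal' (k - t) + phiReal (k - t) * phiReal' t) /
      (1 + phiReal t ^ 2 * phiReal (k - t) ^ 2)) 0 t := by
    intro t
    have hs := hasDerivAt_phiReal t
    have hc := hasDerivAt_phiReal' t
    have hs' := (hasDerivAt_phiReal (k - t)).comp_const_sub k t
    have hc' := (hasDerivAt_phiReal' (k - t)).comp_const_sub k t
    refine (((hs.mul hc').add (hs'.mul hc)).div (((hs.pow 2).mul (hs'.pow 2)).const_add 1)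
      (hden t)).congr_deriv ?_
    rw [div_eq_zero_iff]
    left
    have e1 := phiReal'_sq t
    have e2 := phiReal'_sq (k - t)
    simp only [Pi.mul_apply, Pi.pow_apply, Pi.add_apply]
    generalize phiReal t = a at *
    generalize phiReal' t = A at *
    generalize phiReal (k - t) = b at *
    generalize phiReal' (k - t) = B at *
    push_cast
    linear_combination (-2 * a * b ^ 3) * e1 + 2 * a ^ 3 * b * e2
  have hconst := is_const_of_deriv_eq_zero (fun t => (hder t).differentiableAt)
    (fun t => (hder t).deriv) x 0
  have hy : k - x = y := by rw [hk]; ring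
  simp only [hy, phiReal_zero, phiReal'_zero, sub_zero] at hconst
  have := hden x
  rw [hy] at this
  field_simp at hconst
  linarith

theorem phiReal_add_half_varpi (x : ℝ) :
    phiReal (x + varpi / 2) = phiReal' x / (1 + phiReal x ^ 2) := by
  have h := phiReal_add x (varpi / 2)
  rw [phiReal_half_varpi, phiReal'_half_varpi] at h
  rw [eq_div_iff (by positivity)]
  linarith

theorem phiReal'_add_half_varpi (x : ℝ) :
    phiReal' (x + varpi / 2) = -2 * phiReal x / (1 + phiReal x ^ 2) := by
  have h1 : HasDerivAt (fun x => phiReal (x + varpi / 2)) (phiReal' (x + varpi / 2)) x :=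
    (hasDerivAt_phiReal _).comp_add_const x (varpi / 2)
  have hne : 1 + phiReal x ^ 2 ≠ 0 := by positivity
  have h2 := (hasDerivAt_phiReal' x).div (((hasDerivAt_phiReal x).pow 2).const_add 1) hne
  have e : (fun x => phiReal (x + varpi / 2)) = fun x => phiReal' x / (1 + phiReal x ^ 2) :=
    funext phiReal_add_half_varpi
  rw [e] at h1
  rw [h1.unique h2]
  have := phiReal'_sq x
  simp only [Pi.pow_apply]
  field_simp
  push_cast
  linear_combination (-2 * phiReal x) * this

/-! ### The complex lemniscatic function -/

/-- The poles of `phi`. -/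
def poles : Set ℂ := {z | phiReal z.re ^ 2 * phiReal z.im ^ 2 = 1}

theorem phi_def (z : ℂ) : phi z =
    ((phiReal z.re : ℂ) * phiReal' z.im + I * (phiReal z.im : ℂ) * phiReal' z.re) /
    (1 - (phiReal z.re : ℂ) ^ 2 * (phiReal z.im : ℂ) ^ 2) := by
  rw [phi, deriv_phiReal]

theorem phiReal'_sq_ofReal (x : ℝ) : (phiReal' x : ℂ) ^ 2 = 1 - (phiReal x : ℂ) ^ 4 := by
  exact_mod_cast congrArg ((↑) : ℝ → ℂ) (phiReal'_sq x)

theorem phiReal_sq_le_one (x : ℝ) : phiReal x ^ 2 ≤ 1 := by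
  have h := phiReal_mem_Icc x
  nlinarith [h.1, h.2]

theorem phiReal'_eq_zero_iff {x : ℝ} : phiReal' x = 0 ↔ phiReal x ^ 2 = 1 := by
  have h := phiReal'_sq x
  constructor
  · intro h0
    rw [h0] at h
    nlinarith [sq_nonneg (phiReal x)]
  · intro h1
    have : phiReal' x ^ 2 = 0 := by rw [h]; linear_combination (-1 - phiReal x ^ 2) * h1
    simpa using this

theorem mem_poles {z : ℂ} : z ∈ poles ↔ phiReal z.re ^ 2 = 1 ∧ phiReal z.im ^ 2 = 1 := by
  have h1 := phiReal_sq_le_one z.re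
  have h2 := phiReal_sq_le_one z.im
  rw [poles, Set.mem_ofPred_eq]
  constructor
  · intro h
    constructor <;> nlinarith [sq_nonneg (phiReal z.re), sq_nonneg (phiReal z.im)]
  · rintro ⟨h1, h2⟩
    rw [h1, h2, one_mul]

theorem phiReal_sq_eq_one_iff {x : ℝ} :
    phiReal x ^ 2 = 1 ↔ ∃ n : ℤ, x = n * varpi - varpi / 2 := by
  have h := phiReal_add_half_varpi x
  have hp : 1 + phiReal x ^ 2 ≠ 0 := by positivity
  rw [← phiReal'_eq_zero_iff]
  have : phiReal' x = 0 ↔ phiReal (x + varpi / 2) = 0 := by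
    rw [h, div_eq_zero_iff]
    simp [hp]
  rw [this, phiReal_eq_zero_iff]
  exact exists_congr fun n => ⟨fun h => by linarith, fun h => by linarith⟩

theorem mem_poles_iff {z : ℂ} : z ∈ poles ↔
    ∃ m n : ℤ, z = ((2 * m - 1) + (2 * n - 1) * I) * (varpi / 2) := by
  rw [mem_poles, phiReal_sq_eq_one_iff, phiReal_sq_eq_one_iff]
  constructor
  · rintro ⟨⟨m, hm⟩, n, hn⟩
    refine ⟨m, n, ?_⟩
    rw [← re_add_im z, hm, hn]
    push_cast
    ring
  · rintro ⟨m, n, rfl⟩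
    refine ⟨⟨m, ?_⟩, n, ?_⟩
    · simp
      ring
    · simp
      ring

theorem countable_poles : poles.Countable := by
  refine (Set.countable_range fun p : ℤ × ℤ =>
    ((2 * p.1 - 1) + (2 * p.2 - 1) * I) * (varpi / 2 : ℂ)).mono fun z hz => ?_
  obtain ⟨m, n, rfl⟩ := mem_poles_iff.1 hz
  exact ⟨(m, n), rfl⟩

theorem isClosed_poles : IsClosed poles := by
  have := continuous_phiReal
  exact isClosed_eq (by fun_prop) continuous_const

theorem den_ne_zero {z : ℂ} (hz : z ∉ poles) :
    1 - (phiReal z.re : ℂ) ^ 2 * (phiReal z.im : ℂ) ^ 2 ≠ 0 := by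
  intro h
  apply hz
  rw [poles, Set.mem_ofPred_eq]
  rw [sub_eq_zero] at h
  exact_mod_cast h.symm

/-- The default value at a pole, which lets `phi_add_pole` hold without exceptions. -/
theorem phi_of_mem_poles {z : ℂ} (hz : z ∈ poles) : phi z = 0 := by
  obtain ⟨h1, h2⟩ := mem_poles.1 hz
  simp [phi_def, phiReal'_eq_zero_iff.2 h1, phiReal'_eq_zero_iff.2 h2]

/-- The Cauchy–Riemann equations: the real Fréchet derivative turns out to be multiplication by a
complex number. -/
theorem hasDerivAt_phi {z : ℂ} (hz : z ∉ poles) : HasDerivAt phi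
    (((phiReal' z.re : ℂ) * phiReal' z.im * (1 + (phiReal z.re : ℂ) ^ 2 * (phiReal z.im : ℂ) ^ 2) -
      2 * I * phiReal z.re * phiReal z.im * ((phiReal z.re : ℂ) ^ 2 - (phiReal z.im : ℂ) ^ 2)) /
    (1 - (phiReal z.re : ℂ) ^ 2 * (phiReal z.im : ℂ) ^ 2) ^ 2) z := by
  have hD := den_ne_zero hz
  have h1 := ofRealCLM.hasFDerivAt.comp z
    ((hasDerivAt_phiReal z.re).comp_hasFDerivAt z reCLM.hasFDerivAt)
  have h2 := ofRealCLM.hasFDerivAt.comp z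
    ((hasDerivAt_phiReal z.im).comp_hasFDerivAt z imCLM.hasFDerivAt)
  have h3 := ofRealCLM.hasFDerivAt.comp z
    ((hasDerivAt_phiReal' z.re).comp_hasFDerivAt z reCLM.hasFDerivAt)
  have h4 := ofRealCLM.hasFDerivAt.comp z
    ((hasDerivAt_phiReal' z.im).comp_hasFDerivAt z imCLM.hasFDerivAt)
  have h5 := ((h1.mul h4).add ((h2.const_mul I).mul h3)).mul
    ((hasDerivAt_inv hD).comp_hasFDerivAt_of_eq z (((h1.pow 2).mul (h2.pow 2)).const_sub 1) rfl)
  have h6 : HasFDerivAt phi _ z := h5.congr_of_eventuallyEq (.of_forall fun w => by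
    simp [phi_def, div_eq_mul_inv])
  rw [hasDerivAt_iff_hasFDerivAt]
  refine hasFDerivAt_of_restrictScalars ℝ h6 ?_
  have e1 := phiReal'_sq_ofReal z.re
  have e2 := phiReal'_sq_ofReal z.im
  ext w
  simp
  generalize (phiReal z.re : ℂ) = a at *
  generalize (phiReal z.im : ℂ) = b at *
  generalize (phiReal' z.re : ℂ) = A at *
  generalize (phiReal' z.im : ℂ) = B at *
  have ew : w = w.re + w.im * I := (re_add_im w).symm
  generalize (w.re : ℂ) = x at *
  generalize (w.im : ℂ) = y at *
  subst ew
  field_simp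
  linear_combination (-2 * x * I * a * b ^ 3) * e1 + (-2 * y * a ^ 3 * b) * e2 +
    (y * (2 * a * b ^ 3 - 2 * a ^ 3 * b)) * I_sq

theorem deriv_phi_sq {z : ℂ} (hz : z ∉ poles) : deriv phi z ^ 2 = 1 - phi z ^ 4 := by
  have hD := den_ne_zero hz
  have e1 := phiReal'_sq_ofReal z.re
  have e2 := phiReal'_sq_ofReal z.im
  rw [(hasDerivAt_phi hz).deriv, phi_def]
  generalize (phiReal z.re : ℂ) = a at *
  generalize (phiReal z.im : ℂ) = b at *
  generalize (phiReal' z.re : ℂ) = A at *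
  generalize (phiReal' z.im : ℂ) = B at *
  have e3 : (a * B + I * b * A) ^ 2 =
      a ^ 2 * (1 - b ^ 4) - b ^ 2 * (1 - a ^ 4) + 2 * I * a * b * (A * B) := by
    linear_combination a ^ 2 * e2 - b ^ 2 * e1 + b ^ 2 * A ^ 2 * I_sq
  have e4 : (A * B) ^ 2 = (1 - a ^ 4) * (1 - b ^ 4) := by
    linear_combination B ^ 2 * e1 + (1 - a ^ 4) * e2
  rw [div_pow, div_pow, show (a * B + I * b * A) ^ 4 = ((a * B + I * b * A) ^ 2) ^ 2 by ring, e3]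
  generalize A * B = C at *
  field_simp
  linear_combination ((1 + a ^ 2 * b ^ 2) ^ 2 - 4 * a ^ 2 * b ^ 2) * e4 +
    (4 * a ^ 2 * b ^ 2 * (a ^ 2 - b ^ 2) ^ 2 + 4 * a ^ 2 * b ^ 2 * C ^ 2) * I_sq

theorem phi_I_mul (z : ℂ) : phi (I * z) = I * phi z := by
  simp only [phi_def, I_mul_re, I_mul_im, phiReal_neg, phiReal'_neg]
  rw [← mul_div_assoc]
  congr 1
  · push_cast
    linear_combination (-(phiReal z.im : ℂ) * phiReal' z.re) * I_sq
  · push_cast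
    ring

theorem phi_neg (z : ℂ) : phi (-z) = -phi z := by
  have : -z = I * (I * z) := by rw [← mul_assoc, I_mul_I, neg_one_mul]
  rw [this, phi_I_mul, phi_I_mul, ← mul_assoc, I_mul_I, neg_one_mul]

theorem phi_zero : phi 0 = 0 := by simp [phi_def, phiReal_zero]

theorem antiperiodic_phi : Function.Antiperiodic phi varpi := by
  intro z
  simp only [phi_def, add_re, add_im, ofReal_re, ofReal_im, add_zero, antiperiodic_phiReal z.re,
    antiperiodic_phiReal' z.re]
  push_cast
  rw [neg_sq, ← neg_div]
  congr 1
  ring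

theorem antiperiodic_phi_I : Function.Antiperiodic phi (I * varpi) := by
  intro z
  have h : z + I * varpi = I * (-(I * z) + varpi) := by linear_combination z * I_sq
  rw [h, phi_I_mul, antiperiodic_phi, phi_neg, phi_I_mul]
  linear_combination phi z * I_sq

theorem phi_add_mem {l : ℂ} (hl : l ∈ periods.lattice) (z : ℂ) : phi (z + l) = phi z := by
  obtain ⟨m, n, rfl⟩ := PeriodPair.mem_lattice.1 hl
  have h1 : Function.Periodic phi periods.ω₁ := by
    have := antiperiodic_phi.add antiperiodic_phi_I
    rwa [show (varpi : ℂ) + I * varpi = periods.ω₁ by simp [periods]; ring] at this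
  have h2 : Function.Periodic phi periods.ω₂ := by
    have := antiperiodic_phi.sub antiperiodic_phi_I
    rwa [show (varpi : ℂ) - I * varpi = periods.ω₂ by simp [periods]; ring] at this
  exact ((h1.int_mul m).add_period (h2.int_mul n)) z

theorem deriv_phi_add_mem {l : ℂ} (hl : l ∈ periods.lattice) (z : ℂ) :
    deriv phi (z + l) = deriv phi z := by
  rw [← deriv_comp_add_const]
  simp [phi_add_mem hl]

theorem phi_ofReal (x : ℝ) : phi x = phiReal x := by
  simp [phi_def, phiReal_zero, phiReal'_zero]

theorem ofReal_notMem_poles (x : ℝ) : (x : ℂ) ∉ poles := by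
  simp [mem_poles, phiReal_zero]

theorem zero_notMem_poles : (0 : ℂ) ∉ poles := by
  simpa using ofReal_notMem_poles 0

theorem deriv_phi_ofReal (x : ℝ) : deriv phi x = phiReal' x := by
  rw [(hasDerivAt_phi (ofReal_notMem_poles x)).deriv]
  simp [phiReal_zero, phiReal'_zero]

theorem deriv_phi_zero : deriv phi 0 = 1 := by
  simpa [phiReal'_zero] using deriv_phi_ofReal 0

theorem analyticAt_phi {z : ℂ} (hz : z ∉ poles) : AnalyticAt ℂ phi z :=
  (show DifferentiableOn ℂ phi polesᶜ from fun _ hw =>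
    (hasDerivAt_phi hw).differentiableAt.differentiableWithinAt).analyticAt
    (isClosed_poles.isOpen_compl.mem_nhds hz)

theorem I_mul_mem_poles {z : ℂ} : I * z ∈ poles ↔ z ∈ poles := by
  simp [mem_poles, phiReal_neg, and_comm]

theorem neg_mem_poles {z : ℂ} : -z ∈ poles ↔ z ∈ poles := by
  simp [mem_poles, phiReal_neg]

theorem deriv_phi_I_mul {z : ℂ} (hz : z ∉ poles) : deriv phi (I * z) = deriv phi z := by
  have h1 : HasDerivAt (fun z => phi (I * z)) (deriv phi (I * z) * I) z :=
    ((hasDerivAt_phi (mt I_mul_mem_poles.1 hz)).differentiableAt.hasDerivAt.comp z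
      ((hasDerivAt_id z).const_mul I)).congr_deriv (by simp)
  have h2 := (hasDerivAt_phi hz).differentiableAt.hasDerivAt.const_mul I
  rw [funext phi_I_mul] at h1
  have := h1.unique h2
  rw [mul_comm] at this
  exact mul_left_cancel₀ I_ne_zero this

theorem deriv_phi_neg (z : ℂ) : deriv phi (-z) = deriv phi z := by
  have h := deriv_comp_neg phi z
  simp only [phi_neg, deriv.fun_neg] at h
  exact (neg_injective h).symm

theorem phi_eq_zero_iff {z : ℂ} (hz : z ∉ poles) :
    phi z = 0 ↔ ∃ m n : ℤ, z = (m + n * I) * varpi := by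
  have key : phi z = 0 ↔ phiReal z.re = 0 ∧ phiReal z.im = 0 := by
    rw [phi_def, div_eq_zero_iff]
    simp only [den_ne_zero hz, or_false]
    constructor
    · intro h
      have h1 := congrArg re h
      have h2 := congrArg im h
      simp at h1 h2
      rcases h1 with h1 | h1
      · refine ⟨h1, h2.resolve_right fun h3 => ?_⟩
        have := phiReal'_sq z.re
        rw [h1, h3] at this
        norm_num at this
      · have h3 := phiReal'_eq_zero_iff.1 h1
        rcases h2 with h2 | h2
        · rw [h2] at h3
          norm_num at h3
        · exact absurd (mem_poles.2 ⟨phiReal'_eq_zero_iff.1 h2, h3⟩) hz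
    · rintro ⟨h1, h2⟩
      simp [h1, h2]
  rw [key, phiReal_eq_zero_iff, phiReal_eq_zero_iff]
  constructor
  · rintro ⟨⟨m, hm⟩, n, hn⟩
    refine ⟨m, n, ?_⟩
    rw [← re_add_im z, hm, hn]
    push_cast
    ring
  · rintro ⟨m, n, rfl⟩
    exact ⟨⟨m, by simp⟩, n, by simp⟩

/-- Translation by the pole `(1 + i) ϖ / 2` turns `phi` into `-i / phi`. -/
theorem phi_add_pole (z : ℂ) : phi (z + (1 + I) * (varpi / 2)) = -I / phi z := by
  have hre : (z + (1 + I) * (varpi / 2)).re = z.re + varpi / 2 := by simp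
  have him : (z + (1 + I) * (varpi / 2)).im = z.im + varpi / 2 := by simp
  have e1 := phiReal'_sq_ofReal z.re
  have e2 := phiReal'_sq_ofReal z.im
  have n1 : (1 + (phiReal z.re : ℂ) ^ 2) ≠ 0 := by
    exact_mod_cast (show (1 + phiReal z.re ^ 2) ≠ 0 by positivity)
  have n2 : (1 + (phiReal z.im : ℂ) ^ 2) ≠ 0 := by
    exact_mod_cast (show (1 + phiReal z.im ^ 2) ≠ 0 by positivity)
  -- At a pole and at a zero of φ both sides are 0, through the default values of φ and of division.
  by_cases hz : z ∈ poles
  · rw [phi_of_mem_poles hz, phi_def, hre, him]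
    obtain ⟨h1, h2⟩ := mem_poles.1 hz
    simp [phiReal_add_half_varpi, phiReal'_eq_zero_iff.2 h1, phiReal'_eq_zero_iff.2 h2]
  by_cases h0 : phi z = 0
  · rw [h0, div_zero]
    apply phi_of_mem_poles
    obtain ⟨m, n, rfl⟩ := (phi_eq_zero_iff hz).1 h0
    refine mem_poles_iff.2 ⟨m + 1, n + 1, ?_⟩
    push_cast
    ring
  have hD := den_ne_zero hz
  rw [eq_div_iff h0]
  have h1 : (phiReal z.re : ℂ) ^ 2 + (phiReal z.im : ℂ) ^ 2 ≠ 0 := by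
    intro h
    have h' : phiReal z.re ^ 2 + phiReal z.im ^ 2 = 0 := by exact_mod_cast h
    have ha : phiReal z.re = 0 := by nlinarith [sq_nonneg (phiReal z.re), sq_nonneg (phiReal z.im)]
    have hb : phiReal z.im = 0 := by nlinarith [sq_nonneg (phiReal z.re), sq_nonneg (phiReal z.im)]
    exact h0 (by simp [phi_def, ha, hb])
  rw [phi_def, phi_def, hre, him, phiReal_add_half_varpi, phiReal_add_half_varpi,
    phiReal'_add_half_varpi, phiReal'_add_half_varpi]
  push_cast
  generalize (phiReal z.re : ℂ) = a at *
  generalize (phiReal z.im : ℂ) = b at *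
  generalize (phiReal' z.re : ℂ) = A at *
  generalize (phiReal' z.im : ℂ) = B at *
  have e3 : 1 - (A / (1 + a ^ 2)) ^ 2 * (B / (1 + b ^ 2)) ^ 2 =
      2 * (a ^ 2 + b ^ 2) / ((1 + a ^ 2) * (1 + b ^ 2)) := by
    rw [div_pow, div_pow, e1, e2]
    field_simp
    ring
  rw [e3]
  field_simp
  linear_combination (-I * b ^ 2) * e1 + (-I * a ^ 2) * e2 + (-a * b * A * B) * I_sq

/-! ### Comparison with the Weierstrass function -/

/-- The periods form the index-two sublattice of the zeros ℤ[i]ϖ; the other coset is that of ϖ. -/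
theorem mem_lattice_iff {z : ℂ} : z ∈ periods.lattice ↔
    ∃ m n : ℤ, Even (m + n) ∧ z = (m + n * I) * varpi := by
  rw [PeriodPair.mem_lattice]
  constructor
  · rintro ⟨m, n, rfl⟩
    refine ⟨m + n, m - n, ⟨m, by ring⟩, ?_⟩
    simp only [periods]
    push_cast
    ring
  · rintro ⟨m, n, ⟨k, hk⟩, rfl⟩
    refine ⟨k, m - k, ?_⟩
    have hk' : (m : ℂ) + n = k + k := by exact_mod_cast hk
    simp only [periods]
    push_cast
    linear_combination (-I * varpi) * hk'

theorem int_add_int_mul_I_mul_varpi_inj {m n m' n' : ℤ}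
    (h : ((m : ℂ) + n * I) * varpi = (m' + n' * I) * varpi) : m = m' ∧ n = n' := by
  have h0 : (varpi : ℂ) ≠ 0 := by exact_mod_cast varpi_pos.ne'
  have h := mul_right_cancel₀ h0 h
  have h1 := congrArg re h
  have h2 := congrArg im h
  simp at h1 h2
  exact ⟨by exact_mod_cast h1, by exact_mod_cast h2⟩

theorem varpi_notMem_lattice : (varpi : ℂ) ∉ periods.lattice := by
  intro h
  obtain ⟨m, n, he, h⟩ := mem_lattice_iff.1 h
  obtain ⟨rfl, rfl⟩ := int_add_int_mul_I_mul_varpi_inj (m := 1) (n := 0) (by simpa using h)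
  simp at he

/-- The zeros of `phi`. -/
def zeros : Set ℂ := {z | ∃ m n : ℤ, z = (m + n * I) * varpi}

theorem lattice_subset_zeros {z : ℂ} (hz : z ∈ periods.lattice) : z ∈ zeros := by
  obtain ⟨m, n, -, h⟩ := mem_lattice_iff.1 hz
  exact ⟨m, n, h⟩

theorem add_pole_mem_poles {z : ℂ} : z + (1 + I) * (varpi / 2) ∈ poles ↔ z ∈ zeros := by
  rw [mem_poles_iff]
  constructor
  · rintro ⟨m, n, h⟩
    refine ⟨m - 1, n - 1, ?_⟩
    push_cast
    linear_combination h
  · rintro ⟨m, n, rfl⟩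
    refine ⟨m + 1, n + 1, ?_⟩
    push_cast
    ring

theorem isClosed_zeros : IsClosed zeros := by
  have : zeros = (fun z => z + (1 + I) * (varpi / 2)) ⁻¹' poles :=
    Set.ext fun z => add_pole_mem_poles.symm
  rw [this]
  exact isClosed_poles.preimage (by fun_prop)

theorem countable_zeros : zeros.Countable := by
  refine (Set.countable_range fun p : ℤ × ℤ => (p.1 + p.2 * I) * (varpi : ℂ)).mono fun z hz => ?_
  obtain ⟨m, n, rfl⟩ := hz
  exact ⟨(m, n), rfl⟩

theorem phi_of_mem_zeros {z : ℂ} (hz : z ∈ zeros) : phi z = 0 := by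
  by_cases h : z ∈ poles
  · exact phi_of_mem_poles h
  · exact (phi_eq_zero_iff h).2 hz

theorem zeros_disjoint_poles {z : ℂ} (hz : z ∈ zeros) : z ∉ poles := by
  intro h
  obtain ⟨m, n, rfl⟩ := hz
  obtain ⟨h1, -⟩ := mem_poles.1 h
  rw [phiReal_eq_zero_iff.2 ⟨m, by simp⟩] at h1
  norm_num at h1

/-- Makes 1/φ analytic at the poles of φ with no separate local study there. -/
theorem inv_phi (z : ℂ) : (phi z)⁻¹ = I * phi (z + (1 + I) * (varpi / 2)) := by
  rw [phi_add_pole, div_eq_mul_inv, ← mul_assoc, mul_neg, I_mul_I, neg_neg, one_mul]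

theorem analyticAt_inv_phi {z : ℂ} (hz : z ∉ zeros) : AnalyticAt ℂ (fun z => (phi z)⁻¹) z := by
  simp_rw [inv_phi]
  have := (analyticAt_phi (mt add_pole_mem_poles.1 hz)).fun_comp (g := phi)
    (f := fun z => z + (1 + I) * (varpi / 2)) (by fun_prop)
  fun_prop

/-- Multiplication by `i` on the period lattice. -/
noncomputable def latticeMulI : periods.lattice ≃ periods.lattice where
  toFun l := ⟨I * l, by
    obtain ⟨m, n, ⟨k, hk⟩, h⟩ := mem_lattice_iff.1 l.2
    refine mem_lattice_iff.2 ⟨-n, m, ⟨k - n, by linarith⟩, ?_⟩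
    rw [h]
    push_cast
    linear_combination (n * varpi : ℂ) * I_sq⟩
  invFun l := ⟨-(I * l), by
    obtain ⟨m, n, ⟨k, hk⟩, h⟩ := mem_lattice_iff.1 l.2
    refine mem_lattice_iff.2 ⟨n, -m, ⟨k - m, by linarith⟩, ?_⟩
    rw [h]
    push_cast
    linear_combination (-n * varpi : ℂ) * I_sq⟩
  left_inv l := by
    ext
    simp [← mul_assoc]
  right_inv l := by
    ext
    simp [← mul_assoc]

@[simp]
theorem coe_latticeMulI (l : periods.lattice) : (latticeMulI l : ℂ) = I * l := rfl

/-- Multiplication by i permutes L and multiplies each term of G₆ by i⁻⁶ = -1. -/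
theorem g₃_periods : periods.g₃ = 0 := by
  have : periods.G 6 = -periods.G 6 := by
    conv_lhs => rw [PeriodPair.G, ← latticeMulI.tsum_eq]
    rw [PeriodPair.G, ← tsum_neg]
    congr 1
    ext l
    rw [coe_latticeMulI, mul_pow, show I ^ 6 = -1 by rw [show 6 = 2 * 3 by norm_num, pow_mul, I_sq]; norm_num]
    rw [neg_one_mul, inv_neg]
  rw [PeriodPair.g₃, CharZero.eq_neg_self_iff.1 this, mul_zero]

theorem wp_I_mul (z : ℂ) : wp (I * z) = -wp z := by
  simp only [wp, PeriodPair.weierstrassP]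
  rw [← latticeMulI.tsum_eq, ← tsum_neg]
  congr 1
  ext l
  rw [coe_latticeMulI, ← mul_sub, mul_pow, mul_pow, I_sq, neg_one_mul, neg_one_mul, div_neg,
    div_neg]
  ring

/-- Modulo L, ϖ and iϖ agree, while ℘(iz) = -℘(z). Together with `wp'_varpi` this makes ϖ a multiple
zero of ℘. -/
theorem wp_varpi : wp varpi = 0 := by
  have h1 := wp_I_mul varpi
  have h2 := periods.weierstrassP_sub_coe varpi ⟨_, periods.ω₂_mem_lattice⟩
  have h3 : (varpi : ℂ) - periods.ω₂ = I * varpi := by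
    simp only [periods]
    ring
  simp only [h3] at h2
  exact CharZero.eq_neg_self_iff.1 (h2.symm.trans h1)

theorem wp'_varpi : wp' varpi = 0 := by
  have h1 := periods.derivWeierstrassP_neg varpi
  have h2 := periods.derivWeierstrassP_sub_coe varpi
    ⟨_, add_mem periods.ω₁_mem_lattice periods.ω₂_mem_lattice⟩
  have h3 : (varpi : ℂ) - (periods.ω₁ + periods.ω₂) = -varpi := by
    simp only [periods]
    ring
  simp only [h3] at h2
  exact CharZero.eq_neg_self_iff.1 (h2.symm.trans h1)

theorem hasDerivAt_wp {z : ℂ} (hz : z ∉ periods.lattice) : HasDerivAt wp (wp' z) z := by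
  have := (periods.analyticOnNhd_weierstrassP z hz).differentiableAt.hasDerivAt
  rwa [PeriodPair.deriv_weierstrassP] at this

/-! ### The identity ℘' = -2℘/φ -/

/-- Near 0, (1 - φ')(1 + φ') = φ⁴ with |φ| ≤ 2|z| and |1 + φ'| ≥ 1, so |1 - φ'| ≤ 16|z|⁴; the mean
value inequality gives φ(z) = z + O(z⁵). -/
theorem tendsto_phi_sub_id : Tendsto (fun z => (z - phi z) / z ^ 4) (𝓝[≠] 0) (𝓝 0) := by
  have han := analyticAt_phi zero_notMem_poles
  have h1 : ∀ᶠ z in 𝓝 (0 : ℂ), ‖phi z‖ ≤ 2 * ‖z‖ := by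
    have h := han.differentiableAt.hasDerivAt
    rw [deriv_phi_zero, hasDerivAt_iff_isLittleO_nhds_zero] at h
    filter_upwards [h.bound one_pos] with z hz
    simp [phi_zero] at hz
    linarith [norm_le_norm_sub_add (phi z) z]
  have h2 : ∀ᶠ z in 𝓝 (0 : ℂ), 1 ≤ ‖deriv phi z + 1‖ := by
    have h : Tendsto (fun z => ‖deriv phi z + 1‖) (𝓝 0) (𝓝 ‖deriv phi 0 + 1‖) :=
      ((han.deriv.continuousAt.add continuousAt_const).norm : ContinuousAt _ _)
    rw [deriv_phi_zero] at h
    norm_num at h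
    filter_upwards [h.eventually (lt_mem_nhds one_lt_two)] with z hz using hz.le
  have h3 : ∀ᶠ z in 𝓝 (0 : ℂ), z ∉ poles := isClosed_poles.isOpen_compl.mem_nhds zero_notMem_poles
  obtain ⟨r, hr, hball⟩ := Metric.eventually_nhds_iff_ball.1 (h1.and (h2.and h3))
  have hbound : ∀ z ∈ Metric.ball (0 : ℂ) r, ‖z - phi z‖ ≤ 16 * ‖z‖ ^ 5 := by
    intro z hz
    have hsub : Metric.closedBall (0 : ℂ) ‖z‖ ⊆ Metric.ball 0 r :=
      Metric.closedBall_subset_ball (by simpa using hz)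
    have hd : ∀ w ∈ Metric.closedBall (0 : ℂ) ‖z‖,
        HasDerivWithinAt (fun w => w - phi w) (1 - deriv phi w) (Metric.closedBall (0 : ℂ) ‖z‖) w :=
      fun w hw => ((hasDerivAt_id w).sub
        (analyticAt_phi (hball w (hsub hw)).2.2).differentiableAt.hasDerivAt).hasDerivWithinAt
    have hb : ∀ w ∈ Metric.closedBall (0 : ℂ) ‖z‖, ‖1 - deriv phi w‖ ≤ 16 * ‖z‖ ^ 4 := by
      intro w hw
      obtain ⟨b1, b2, b3⟩ := hball w (hsub hw)
      have hw' : ‖w‖ ≤ ‖z‖ := by simpa using hw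
      have e : (1 - deriv phi w) * (deriv phi w + 1) = phi w ^ 4 := by
        linear_combination -deriv_phi_sq b3
      have e' := congrArg norm e
      rw [norm_mul, norm_pow] at e'
      have : ‖phi w‖ ^ 4 ≤ (2 * ‖z‖) ^ 4 :=
        pow_le_pow_left₀ (norm_nonneg _) (b1.trans (by linarith)) 4
      nlinarith [norm_nonneg (1 - deriv phi w)]
    have := (convex_closedBall (0 : ℂ) ‖z‖).norm_image_sub_le_of_norm_hasDerivWithin_le hd hb
      (x := 0) (y := z) (by simp) (by simp)
    simp only [phi_zero, sub_zero] at this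
    linarith
  rw [tendsto_zero_iff_norm_tendsto_zero]
  refine squeeze_zero' (g := fun z => 16 * ‖z‖) (.of_forall fun _ => norm_nonneg _) ?_ ?_
  · filter_upwards [self_mem_nhdsWithin, mem_nhdsWithin_of_mem_nhds (Metric.ball_mem_nhds 0 hr)]
      with z hz hzr
    have hz' : 0 < ‖z‖ := norm_pos_iff.2 hz
    rw [norm_div, norm_pow, div_le_iff₀ (by positivity)]
    linarith [hbound z hzr]
  · have : Tendsto (fun z : ℂ => 16 * ‖z‖) (𝓝 0) (𝓝 (16 * ‖(0 : ℂ)‖)) :=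
      Continuous.tendsto (by fun_prop) 0
    simp only [norm_zero, mul_zero] at this
    exact this.mono_left nhdsWithin_le_nhds

theorem tendsto_sub_div_phi {a : ℂ} (ha : a ∈ zeros) :
    Tendsto (fun z => (z - a) / phi z) (𝓝[≠] a) (𝓝 (deriv phi a)⁻¹) := by
  have hp := zeros_disjoint_poles ha
  have hd := deriv_phi_sq hp
  rw [phi_of_mem_zeros ha] at hd
  have hne : deriv phi a ≠ 0 := by
    intro h
    rw [h] at hd
    norm_num at hd
  have h := hasDerivAt_iff_tendsto_slope.1 (analyticAt_phi hp).differentiableAt.hasDerivAt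
  refine (h.inv₀ hne).congr fun z => ?_
  simp [slope, phi_of_mem_zeros ha, div_eq_mul_inv, mul_comm]

/-- The function `℘' + 2 ℘ / φ`, which is identically zero. -/
noncomputable def defect (z : ℂ) : ℂ := wp' z + 2 * wp z / phi z

theorem defect_add_mem {l : ℂ} (hl : l ∈ periods.lattice) (z : ℂ) : defect (z + l) = defect z := by
  simp only [defect, phi_add_mem hl, wp, wp', periods.weierstrassP_add_coe z ⟨l, hl⟩,
    periods.derivWeierstrassP_add_coe z ⟨l, hl⟩]

theorem eventually_phi_ne_zero {a : ℂ} (ha : a ∈ zeros) : ∀ᶠ z in 𝓝[≠] a, phi z ≠ 0 := by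
  have hp := zeros_disjoint_poles ha
  have hd := deriv_phi_sq hp
  rw [phi_of_mem_zeros ha] at hd
  have hne : deriv phi a ≠ 0 := by
    intro h
    rw [h] at hd
    norm_num at hd
  have := (analyticAt_phi hp).differentiableAt.hasDerivAt.eventually_ne hne (c := 0)
  exact this

/-- The defect is (℘' + 2/z³) + 2·(℘ - 1/z²)/z·(z/φ) + 2·(z - φ)/z⁴·(z/φ), and each summand tends to
0, the default value at 0. -/
theorem continuousAt_defect_zero : ContinuousAt defect 0 := by
  have h0 : defect 0 = 0 := by simp [defect, phi_zero]
  rw [continuousAt_iff_punctured_nhds, h0]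
  have z0 : (0 : ℂ) ∈ zeros := ⟨0, 0, by simp⟩
  have t1 : Tendsto (periods.derivWeierstrassPExcept 0) (𝓝[≠] 0) (𝓝 0) := by
    have := (periods.analyticAt_derivWeierstrassPExcept 0).continuousAt.tendsto
    rw [PeriodPair.derivWeierstrassPExcept_zero_zero] at this
    exact this.mono_left nhdsWithin_le_nhds
  have t2 : Tendsto (fun z => periods.weierstrassPExcept 0 z / z) (𝓝[≠] 0) (𝓝 0) := by
    have := (periods.analyticAt_weierstrassPExcept 0).differentiableAt.hasDerivAt
    rw [PeriodPair.deriv_weierstrassPExcept_same, PeriodPair.derivWeierstrassPExcept_zero_zero,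
      hasDerivAt_iff_tendsto_slope] at this
    refine this.congr fun z => ?_
    simp [slope, div_eq_mul_inv, mul_comm]
  have t3 := tendsto_sub_div_phi z0
  simp only [sub_zero] at t3
  have t := t1.add (((t2.mul t3).const_mul 2).add ((tendsto_phi_sub_id.mul t3).const_mul 2))
  simp only [zero_mul, mul_zero, add_zero] at t
  refine t.congr' ?_
  filter_upwards [self_mem_nhdsWithin, eventually_phi_ne_zero z0] with z hz hphi
  have e1 := periods.weierstrassPExcept_add 0 z
  have e2 := periods.derivWeierstrassPExcept_sub 0 z
  have hz : z ≠ 0 := hz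
  simp at e1 e2
  rw [defect, wp, wp', ← e1, ← e2]
  field_simp
  ring

/-- The multiple zero of ℘ at ϖ outweighs the simple zero of φ. -/
theorem continuousAt_defect_varpi : ContinuousAt defect varpi := by
  have zv : (varpi : ℂ) ∈ zeros := ⟨1, 0, by simp⟩
  have h0 : defect varpi = 0 := by simp [defect, phi_of_mem_zeros zv, wp'_varpi]
  rw [continuousAt_iff_punctured_nhds, h0]
  have t1 : Tendsto wp' (𝓝[≠] varpi) (𝓝 0) := by
    have := (periods.analyticOnNhd_derivWeierstrassP _ varpi_notMem_lattice).continuousAt.tendsto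
    rw [show periods.derivWeierstrassP varpi = 0 from wp'_varpi] at this
    exact this.mono_left nhdsWithin_le_nhds
  have t2 : Tendsto (fun z => wp z / (z - varpi)) (𝓝[≠] varpi) (𝓝 0) := by
    have := hasDerivAt_wp varpi_notMem_lattice
    rw [wp'_varpi, hasDerivAt_iff_tendsto_slope] at this
    refine this.congr fun z => ?_
    simp [slope, div_eq_mul_inv, mul_comm, wp_varpi]
  have t := t1.add ((t2.mul (tendsto_sub_div_phi zv)).const_mul 2)
  simp only [zero_mul, mul_zero, add_zero] at t
  refine t.congr' ?_
  filter_upwards [self_mem_nhdsWithin] with z hz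
  have hz : z - varpi ≠ 0 := sub_ne_zero.2 hz
  rw [defect]
  field_simp

theorem differentiableAt_defect_of_notMem {z : ℂ} (hz : z ∉ zeros) : DifferentiableAt ℂ defect z := by
  have hl : z ∉ periods.lattice := mt lattice_subset_zeros hz
  have h1 := (periods.analyticOnNhd_derivWeierstrassP _ hl).differentiableAt
  have h2 := (hasDerivAt_wp hl).differentiableAt
  exact h1.add ((h2.const_mul 2).mul (analyticAt_inv_phi hz).differentiableAt)

theorem differentiable_defect : Differentiable ℂ defect := by
  intro z
  by_cases hz : z ∈ zeros
  · refine (analyticAt_of_differentiable_on_punctured_nhds_of_continuousAt ?_ ?_).differentiableAt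
    · filter_upwards [eventually_phi_ne_zero hz] with w hw
      exact differentiableAt_defect_of_notMem (mt phi_of_mem_zeros hw)
    · have shift : ∀ a l : ℂ, l ∈ periods.lattice → ContinuousAt defect a →
          ContinuousAt defect (a + l) := by
        intro a l hl ha
        have h1 : ContinuousAt (fun w => defect (w - l)) (a + l) :=
          ContinuousAt.comp_of_eq (f := fun w => w - l) (g := defect) ha
            (Continuous.continuousAt (by fun_prop)) (by simp)
        refine h1.congr (.of_forall fun w => ?_)
        simpa using (defect_add_mem hl (w - l)).symm
      obtain ⟨m, n, rfl⟩ := hz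
      -- By parity, each zero of φ is a translate by L of 0 or of ϖ.
      rcases Int.even_or_odd (m + n) with h | h
      · simpa using shift 0 _ (mem_lattice_iff.2 ⟨m, n, h, rfl⟩) continuousAt_defect_zero
      · have := shift varpi _ (mem_lattice_iff.2 ⟨m - 1, n, by
          rw [show m - 1 + n = m + n - 1 by ring]; exact h.sub_odd odd_one, rfl⟩)
          continuousAt_defect_varpi
        convert this using 1
        push_cast
        ring
  · exact differentiableAt_defect_of_notMem hz

/-- Liouville: an entire L-periodic function is bounded, hence constant. -/
theorem defect_eq_zero (z : ℂ) : defect z = 0 := by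
  have h := differentiable_defect.apply_eq_apply_of_bounded
    (IsZLattice.isCompact_range_of_periodic periods.lattice _ differentiable_defect.continuous
      fun z w hw => defect_add_mem hw z).isBounded z 0
  rw [h]
  simp [defect, phi_zero]

theorem wp'_eq (z : ℂ) : wp' z = -2 * wp z / phi z := by
  have := defect_eq_zero z
  rw [defect] at this
  rw [eq_neg_of_add_eq_zero_left this]
  ring

/-! ### The relation 1 + φ' = 2φ²℘ and the value of g₂ -/

theorem isPreconnected_compl_of_countable {s : Set ℂ} (hs : s.Countable) : IsPreconnected sᶜ :=
  (hs.isPathConnected_compl_of_one_lt_rank (by simp)).isConnected.isPreconnected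

theorem phi_sq_mul {z : ℂ} (hz : z ∉ zeros) (hp : z ∉ poles) (hw : wp z ≠ 0) :
    phi z ^ 2 * (4 * wp z ^ 2 - periods.g₂) = 4 * wp z := by
  have h0 : phi z ≠ 0 := mt (phi_eq_zero_iff hp).1 hz
  have h1 := periods.derivWeierstrassP_sq z (mt lattice_subset_zeros hz)
  have h2 := wp'_eq z
  rw [g₃_periods, sub_zero] at h1
  rw [wp'] at h2
  rw [h2, div_pow, div_eq_iff (by positivity)] at h1
  apply mul_left_cancel₀ hw
  rw [wp] at *
  linear_combination -h1

/-- Differentiate φ²(4℘² - g₂) = 4℘, substitute ℘' = -2℘/φ and cancel ℘. The identity theorem later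
removes the condition ℘(z) ≠ 0. -/
theorem one_add_deriv_phi_of_ne {z : ℂ} (hz : z ∉ zeros) (hp : z ∉ poles) (hw : wp z ≠ 0) :
    1 + deriv phi z = 2 * phi z ^ 2 * wp z := by
  have h0 : phi z ≠ 0 := mt (phi_eq_zero_iff hp).1 hz
  have d1 := hasDerivAt_wp (mt lattice_subset_zeros hz)
  have d2 := (analyticAt_phi hp).differentiableAt.hasDerivAt
  have d3 := ((d2.pow 2).mul (((d1.pow 2).const_mul 4).sub_const periods.g₂)).sub (d1.const_mul 4)
  have ev : ∀ᶠ w in 𝓝 z, phi w ^ 2 * (4 * wp w ^ 2 - periods.g₂) - 4 * wp w = 0 := by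
    filter_upwards [isClosed_zeros.isOpen_compl.mem_nhds hz, isClosed_poles.isOpen_compl.mem_nhds hp,
      d1.continuousAt.eventually_ne hw] with w h1 h2 h3
    rw [phi_sq_mul h1 h2 h3, sub_self]
  have d4 := d3.unique ((hasDerivAt_const z (0 : ℂ)).congr_of_eventuallyEq ev)
  have e1 := phi_sq_mul hz hp hw
  have e2 := wp'_eq z
  simp only [Pi.pow_apply] at d4
  rw [e2] at d4
  field_simp at d4
  push_cast at d4
  have : wp z * (1 + deriv phi z - 2 * phi z ^ 2 * wp z) = 0 := by
    linear_combination d4 / 8 - (deriv phi z / 4) * e1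
  exact sub_eq_zero.1 ((mul_eq_zero.1 this).resolve_left hw)

theorem exists_wp_ne_zero : ∃ z, z ∉ zeros ∧ z ∉ poles ∧ wp z ≠ 0 := by
  have z0 : (0 : ℂ) ∈ zeros := ⟨0, 0, by simp⟩
  have h1 : Tendsto wp (𝓝[≠] 0) (Bornology.cobounded ℂ) :=
    tendsto_cobounded_of_meromorphicOrderAt_neg (by
      rw [periods.order_weierstrassP 0 (zero_mem _)]
      decide)
  have h2 := h1.eventually (Bornology.eventually_ne_cobounded 0)
  have h3 : ∀ᶠ z in 𝓝[≠] (0 : ℂ), z ∉ poles :=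
    mem_nhdsWithin_of_mem_nhds (isClosed_poles.isOpen_compl.mem_nhds zero_notMem_poles)
  obtain ⟨z, h1, h2, h3⟩ := (h2.and (h3.and (eventually_phi_ne_zero z0))).exists
  exact ⟨z, mt phi_of_mem_zeros h3, h2, h1⟩

theorem one_add_deriv_phi {z : ℂ} (hz : z ∉ zeros) (hp : z ∉ poles) :
    1 + deriv phi z = 2 * phi z ^ 2 * wp z := by
  obtain ⟨z₀, h1, h2, h3⟩ := exists_wp_ne_zero
  have han : AnalyticOnNhd ℂ (fun z => 1 + deriv phi z - 2 * phi z ^ 2 * wp z) (zeros ∪ poles)ᶜ := by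
    intro w hw
    rw [Set.mem_compl_iff, Set.mem_union, not_or] at hw
    have a1 := analyticAt_phi hw.2
    have a2 := periods.analyticOnNhd_weierstrassP _ (mt lattice_subset_zeros hw.1)
    have a3 := a1.deriv
    fun_prop
  have := han.eqOn_zero_of_preconnected_of_frequently_eq_zero
    (isPreconnected_compl_of_countable (countable_zeros.union countable_poles))
    (z₀ := z₀) (by simp [h1, h2]) (by
      refine Eventually.frequently (mem_nhdsWithin_of_mem_nhds ?_)
      filter_upwards [isClosed_zeros.isOpen_compl.mem_nhds h1,
        isClosed_poles.isOpen_compl.mem_nhds h2,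
        (hasDerivAt_wp (mt lattice_subset_zeros h1)).continuousAt.eventually_ne h3] with w b1 b2 b3
      rw [one_add_deriv_phi_of_ne b1 b2 b3, sub_self])
    (show z ∈ (zeros ∪ poles)ᶜ by simp [hz, hp])
  exact sub_eq_zero.1 this

theorem g₂_periods : periods.g₂ = -1 := by
  obtain ⟨z, h1, h2, h3⟩ := exists_wp_ne_zero
  have h0 : phi z ≠ 0 := mt (phi_eq_zero_iff h2).1 h1
  have e1 := one_add_deriv_phi h1 h2
  have e2 := deriv_phi_sq h2
  have e3 := phi_sq_mul h1 h2 h3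
  have : phi z ^ 4 * (periods.g₂ + 1) = 0 := by
    rw [eq_sub_of_add_eq' e1] at e2
    linear_combination e2 - phi z ^ 2 * e3
  exact eq_neg_of_add_eq_zero_left ((mul_eq_zero.1 this).resolve_left (pow_ne_zero 4 h0))

/-! ### The addition formula -/

theorem frequently_ofReal_nhdsNE_zero {p : ℂ → Prop} (h : ∀ᶠ x : ℝ in 𝓝 0, p x) :
    ∃ᶠ z in 𝓝[≠] (0 : ℂ), p z := by
  have h1 : Tendsto ((↑) : ℝ → ℂ) (𝓝[≠] 0) (𝓝[≠] 0) := by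
    refine tendsto_nhdsWithin_iff.2 ⟨?_, ?_⟩
    · have := continuous_ofReal.tendsto 0
      rw [ofReal_zero] at this
      exact this.mono_left nhdsWithin_le_nhds
    · filter_upwards [self_mem_nhdsWithin] with x hx
      simpa using hx
  exact h1.frequently (h.filter_mono nhdsWithin_le_nhds).frequently

theorem preimage_add_right_countable {s : Set ℂ} (hs : s.Countable) (w : ℂ) :
    {z | z + w ∈ s}.Countable :=
  hs.preimage (add_left_injective w)

theorem analyticOnNhd_addition_defect (w : ℂ) :
    AnalyticOnNhd ℂ (fun z => (1 + phi z ^ 2 * phi w ^ 2) * phi (z + w) -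
      (phi z * deriv phi w + phi w * deriv phi z)) (poles ∪ {z | z + w ∈ poles})ᶜ := by
  intro z hz
  rw [Set.mem_compl_iff, Set.mem_union, not_or] at hz
  have a1 := analyticAt_phi hz.1
  have a2 := a1.deriv
  have a3 := (analyticAt_phi hz.2).fun_comp (g := phi) (f := fun z => z + w) (by fun_prop)
  fun_prop

theorem phi_add_of_frequently {w : ℂ} (hw : w ∉ poles)
    (h : ∀ᶠ x : ℝ in 𝓝 0, (1 + phi x ^ 2 * phi w ^ 2) * phi (x + w) =
      phi x * deriv phi w + phi w * deriv phi x) {z : ℂ} (hz : z ∉ poles) (hzw : z + w ∉ poles) :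
    (1 + phi z ^ 2 * phi w ^ 2) * phi (z + w) = phi z * deriv phi w + phi w * deriv phi z := by
  have := (analyticOnNhd_addition_defect w).eqOn_zero_of_preconnected_of_frequently_eq_zero
    (isPreconnected_compl_of_countable
      (countable_poles.union (preimage_add_right_countable countable_poles w)))
    (z₀ := 0) (by simp [zero_notMem_poles, hw])
    (frequently_ofReal_nhdsNE_zero (h.mono fun x hx => sub_eq_zero.2 hx))
    (show z ∈ _ by simp [hz, hzw])
  exact sub_eq_zero.1 this

/-- Analytic continuation of the real formula, one variable at a time; its symmetry exchanges the
two variables. -/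
theorem phi_add {z w : ℂ} (hz : z ∉ poles) (hw : w ∉ poles) (hzw : z + w ∉ poles) :
    (1 + phi z ^ 2 * phi w ^ 2) * phi (z + w) = phi z * deriv phi w + phi w * deriv phi z := by
  refine phi_add_of_frequently hw ?_ hz hzw
  have hev : ∀ᶠ x : ℝ in 𝓝 0, (w + x : ℂ) ∉ poles := by
    have : Continuous fun x : ℝ => w + (x : ℂ) := by fun_prop
    exact this.continuousAt.eventually (isClosed_poles.isOpen_compl.mem_nhds (by simpa using hw))
  filter_upwards [hev] with x hx
  have := phi_add_of_frequently (ofReal_notMem_poles x) (.of_forall fun y => ?_) hw hx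
  · rw [add_comm (x : ℂ)]
    linear_combination this
  · rw [← ofReal_add]
    simp only [phi_ofReal, deriv_phi_ofReal]
    exact_mod_cast phiReal_add y x

/-- Addition with w = iz has the factor 1 - φ⁴ = φ'² on the left; cancelling φ' is allowed near 0,
and the identity theorem does the rest. -/
theorem phi_one_add_I_mul {z : ℂ} (hz : z ∉ poles) (hz' : (1 + I) * z ∉ poles) :
    phi ((1 + I) * z) * deriv phi z = (1 + I) * phi z := by
  have h0 : (1 + I : ℂ) ≠ 0 := fun h => by simpa using congrArg re h
  have han : AnalyticOnNhd ℂ (fun z => phi ((1 + I) * z) * deriv phi z - (1 + I) * phi z)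
      (poles ∪ {z | (1 + I) * z ∈ poles})ᶜ := by
    intro z hz
    rw [Set.mem_compl_iff, Set.mem_union, not_or] at hz
    have a1 := analyticAt_phi hz.1
    have a2 := a1.deriv
    have a3 := (analyticAt_phi hz.2).fun_comp (g := phi) (f := fun z => (1 + I) * z) (by fun_prop)
    fun_prop
  have hev : ∀ᶠ z in 𝓝 (0 : ℂ), phi ((1 + I) * z) * deriv phi z - (1 + I) * phi z = 0 := by
    have c1 : ContinuousAt (deriv phi) 0 := (analyticAt_phi zero_notMem_poles).deriv.continuousAt
    have c2 : ContinuousAt (fun z : ℂ => (1 + I) * z) 0 := Continuous.continuousAt (by fun_prop)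
    filter_upwards [c1.eventually_ne (show deriv phi 0 ≠ 0 by simp [deriv_phi_zero]),
      isClosed_poles.isOpen_compl.mem_nhds zero_notMem_poles,
      c2.eventually (isClosed_poles.isOpen_compl.mem_nhds (by simp [zero_notMem_poles]))]
      with z h1 h2 h3
    have e : (1 + I) * z = z + I * z := by ring
    rw [e] at h3 ⊢
    have e1 := phi_add h2 (mt I_mul_mem_poles.1 h2) h3
    have e2 := deriv_phi_sq h2
    rw [phi_I_mul, deriv_phi_I_mul h2, mul_pow, I_sq] at e1
    apply (mul_eq_zero.1 (?_ : deriv phi z * _ = 0)).resolve_left h1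
    linear_combination e1 + phi (z + I * z) * e2
  exact sub_eq_zero.1 <| han.eqOn_zero_of_preconnected_of_frequently_eq_zero
    (isPreconnected_compl_of_countable
      (countable_poles.union (countable_poles.preimage (mul_right_injective₀ h0))))
    (z₀ := 0) (by simp [zero_notMem_poles]) (hev.filter_mono nhdsWithin_le_nhds).frequently
    (show z ∈ _ by simp [hz, hz'])

/-- If it vanished, the formulas for z + w and z - w would give φ(w)φ'(z) = 0, hence φ'(z) = 0, and
then φ(z) = 0 by `phi_one_add_I_mul`. -/
theorem one_add_phi_sq_mul_ne_zero {z w : ℂ} (hz : z ∉ poles) (hz' : (1 + I) * z ∉ poles)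
    (hw : w ∉ poles) (hzw : z + w ∉ poles) (hzw' : z - w ∉ poles) :
    1 + phi z ^ 2 * phi w ^ 2 ≠ 0 := by
  intro h
  have e1 := phi_add hz hw hzw
  have e2 := phi_add hz (mt neg_mem_poles.1 hw) (by rwa [← sub_eq_add_neg])
  have e3 := phi_one_add_I_mul hz hz'
  rw [phi_neg, deriv_phi_neg, neg_sq, h] at e2
  rw [h] at e1
  have hz0 : phi z ≠ 0 := fun h0 => by norm_num [h0] at h
  have hw0 : phi w ≠ 0 := fun h0 => by norm_num [h0] at h
  have e4 : phi w * deriv phi z = 0 := by linear_combination -(e1 - e2) / 2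
  rw [(mul_eq_zero.1 e4).resolve_left hw0, mul_zero] at e3
  have h0 : (1 + I : ℂ) ≠ 0 := fun h => by simpa using congrArg re h
  exact mul_ne_zero h0 hz0 e3.symm

theorem phi_add_add_phi_sub {z w : ℂ} (hz : z ∉ poles) (hz' : (1 + I) * z ∉ poles)
    (hw : w ∉ poles) (hzw : z + w ∉ poles) (hzw' : z - w ∉ poles) :
    phi (z + w) + phi (z - w) = 2 * phi z * deriv phi w / (1 + phi z ^ 2 * phi w ^ 2) := by
  have e1 := phi_add hz hw hzw
  have e2 := phi_add hz (mt neg_mem_poles.1 hw) (by rwa [← sub_eq_add_neg])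
  rw [phi_neg, deriv_phi_neg, neg_sq, ← sub_eq_add_neg] at e2
  rw [eq_div_iff (one_add_phi_sq_mul_ne_zero hz hz' hw hzw hzw')]
  linear_combination e1 + e2

/-! ### Torsion points -/

/-- Reduction modulo 1 + i is a + bi ↦ a + b modulo 2. -/
theorem IsOdd.odd_re_add_im {β : GaussianInt} (hβ : IsOdd β) : Odd (β.re + β.im) := by
  obtain ⟨u, v, h⟩ := hβ
  have h1 := congrArg Zsqrtd.re h
  have h2 := congrArg Zsqrtd.im h
  simp at h1 h2
  by_contra hodd
  rw [Int.not_odd_iff_even] at hodd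
  obtain ⟨k, hk⟩ := hodd
  have : 2 * (u.re * k + u.im * k - u.im * β.im + v.re) = 1 := by
    linear_combination h1 + h2 - (u.re + u.im) * hk
  omega

theorem IsOdd.toComplex_ne_zero {β : GaussianInt} (hβ : IsOdd β) : (β : ℂ) ≠ 0 := by
  intro h
  rw [GaussianInt.toComplex_eq_zero] at h
  have := hβ.odd_re_add_im
  simp [h] at this

theorem mul_mem_lattice (α : GaussianInt) {l : ℂ} (hl : l ∈ periods.lattice) :
    (α : ℂ) * l ∈ periods.lattice :=
  L.smul_mem α hl

section

variable {β : GaussianInt} {z : ℂ}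

/-- An odd β keeps the odd numerators of a pole odd, so β times a pole is not even in ℤ[i]ϖ. -/
theorem notMem_poles_of_mul_mem (hβ : IsOdd β) (hz : (β : ℂ) * z ∈ periods.lattice) :
    z ∉ poles := by
  intro h
  obtain ⟨a, b, rfl⟩ := mem_poles_iff.1 h
  obtain ⟨m, n, -, hmn⟩ := mem_lattice_iff.1 hz
  obtain ⟨k, hk⟩ := hβ.odd_re_add_im
  have e : ((β.re * (2 * a - 1) - β.im * (2 * b - 1) : ℤ) +
      (β.re * (2 * b - 1) + β.im * (2 * a - 1) : ℤ) * I) * varpi =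
      ((2 * m : ℤ) + (2 * n : ℤ) * I) * varpi := by
    rw [GaussianInt.toComplex_def] at hmn
    push_cast
    linear_combination 2 * hmn - β.im * (2 * b - 1) * varpi * I_sq
  have e1 := (int_add_int_mul_I_mul_varpi_inj e).1
  have : 2 * (β.re * a - β.im * b + β.im - k - m) = 1 := by linear_combination e1 + hk
  omega

theorem mem_lattice_of_mem_zeros (hβ : IsOdd β) (hz : (β : ℂ) * z ∈ periods.lattice)
    (h : z ∈ zeros) : z ∈ periods.lattice := by
  obtain ⟨a, b, rfl⟩ := h
  refine mem_lattice_iff.2 ⟨a, b, ?_, rfl⟩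
  obtain ⟨m, n, he, hmn⟩ := mem_lattice_iff.1 hz
  obtain ⟨k, hk⟩ := hβ.odd_re_add_im
  have e : ((β.re * a - β.im * b : ℤ) + (β.re * b + β.im * a : ℤ) * I) * varpi =
      (m + n * I) * varpi := by
    rw [GaussianInt.toComplex_def] at hmn
    push_cast
    linear_combination hmn - β.im * b * varpi * I_sq
  obtain ⟨e1, e2⟩ := int_add_int_mul_I_mul_varpi_inj e
  obtain ⟨j, hj⟩ := he
  refine ⟨j - a * k - b * k + β.im * b, ?_⟩
  linear_combination hj + e1 + e2 - (a + b) * hk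

theorem phi_eq_zero_iff_mem_lattice (hβ : IsOdd β) (hz : (β : ℂ) * z ∈ periods.lattice) :
    phi z = 0 ↔ z ∈ periods.lattice :=
  ⟨fun h => mem_lattice_of_mem_zeros hβ hz ((phi_eq_zero_iff (notMem_poles_of_mul_mem hβ hz)).1 h),
    fun h => phi_of_mem_zeros (lattice_subset_zeros h)⟩

theorem mul_mul_mem_lattice (α : GaussianInt) (hz : (β : ℂ) * z ∈ periods.lattice) :
    (β : ℂ) * (α * z) ∈ periods.lattice := by
  rw [mul_left_comm]
  exact mul_mem_lattice α hz

theorem deriv_phi_of_mem_lattice (hz : z ∈ periods.lattice) : deriv phi z = 1 := by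
  have := deriv_phi_add_mem hz 0
  rwa [zero_add, deriv_phi_zero] at this

theorem toComplex_one_add_I : ((⟨1, 1⟩ : GaussianInt) : ℂ) = 1 + I := by
  simp [GaussianInt.toComplex_def]

theorem one_add_I_ne_zero : (1 + I : ℂ) ≠ 0 := fun h => by simpa using congrArg re h

theorem one_add_I_mul_mem_lattice (hz : (β : ℂ) * z ∈ periods.lattice) :
    (β : ℂ) * ((1 + I) * z) ∈ periods.lattice := by
  have := mul_mul_mem_lattice ⟨1, 1⟩ hz
  rwa [toComplex_one_add_I] at this

theorem phi_one_add_I_mul_of_torsion (hβ : IsOdd β) (hz : (β : ℂ) * z ∈ periods.lattice) :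
    phi ((1 + I) * z) * deriv phi z = (1 + I) * phi z :=
  phi_one_add_I_mul (notMem_poles_of_mul_mem hβ hz)
    (notMem_poles_of_mul_mem hβ (one_add_I_mul_mem_lattice hz))

theorem deriv_phi_ne_zero (hβ : IsOdd β) (hz : (β : ℂ) * z ∈ periods.lattice) :
    deriv phi z ≠ 0 := by
  by_cases h : z ∈ periods.lattice
  · simp [deriv_phi_of_mem_lattice h]
  · intro h0
    have := phi_one_add_I_mul_of_torsion hβ hz
    rw [h0, mul_zero] at this
    exact mul_ne_zero one_add_I_ne_zero (mt (phi_eq_zero_iff_mem_lattice hβ hz).1 h) this.symm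

theorem phi_add_add_phi_sub_of_torsion {w : ℂ} (hβ : IsOdd β) (hz : (β : ℂ) * z ∈ periods.lattice)
    (hw : (β : ℂ) * w ∈ periods.lattice) :
    phi (z + w) + phi (z - w) = 2 * phi z * deriv phi w / (1 + phi z ^ 2 * phi w ^ 2) :=
  phi_add_add_phi_sub (notMem_poles_of_mul_mem hβ hz)
    (notMem_poles_of_mul_mem hβ (one_add_I_mul_mem_lattice hz)) (notMem_poles_of_mul_mem hβ hw)
    (notMem_poles_of_mul_mem hβ (by rw [mul_add]; exact add_mem hz hw))
    (notMem_poles_of_mul_mem hβ (by rw [mul_sub]; exact sub_mem hz hw))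

end

/-! ### Fields generated by torsion values -/

theorem I_mem (F : IntermediateField K ℂ) : I ∈ F :=
  F.algebraMap_mem (⟨I, IntermediateField.subset_adjoin ℚ {I} rfl⟩ : K)

/-- For `c² ∈ F`: membership in `c F` if `k` is even, and in `F` if `k` is odd. -/
def ParityMem (F : IntermediateField K ℂ) (c : ℂ) (k : ℤ) (x : ℂ) : Prop :=
  (Even k → x * c ∈ F) ∧ (Odd k → x ∈ F)

/-- One step of the recurrence: y² ∈ F in either parity, so the quotient lies in the class of yc,
which is opposite to that of y and equal to that of x. -/
theorem ParityMem.neg_add {F : IntermediateField K ℂ} {c : ℂ} (hc0 : c ≠ 0) (hc : c ^ 2 ∈ F)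
    {k k' : ℤ} {s x y : ℂ} (hs : s ^ 2 ∈ F) (hx : ParityMem F c k x) (hy : ParityMem F c k' y)
    (hk : Odd (k' - k)) :
    ParityMem F c k (2 * y * c / (1 + y ^ 2 * s ^ 2) - x) := by
  have h2 : (2 : ℂ) ∈ F := ofNat_mem F 2
  constructor
  · intro he
    have hy' := hy.2 (by simpa using hk.add_even he)
    have e : (2 * y * c / (1 + y ^ 2 * s ^ 2) - x) * c =
        2 * y * c ^ 2 / (1 + y ^ 2 * s ^ 2) - x * c := by ring
    rw [e]
    exact sub_mem (div_mem (mul_mem (mul_mem h2 hy') hc)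
      (add_mem (one_mem F) (mul_mem (pow_mem hy' 2) hs))) (hx.1 he)
  · intro ho
    have hy' := hy.1 (by simpa using hk.add_odd ho)
    have e : y ^ 2 = (y * c) ^ 2 / c ^ 2 := by field_simp
    have e' : 2 * y * c = 2 * (y * c) := by ring
    rw [e, e']
    exact sub_mem (div_mem (mul_mem h2 hy')
      (add_mem (one_mem F) (mul_mem (div_mem (pow_mem hy' 2) hc) hs))) (hx.2 ho)

theorem ParityMem.congr {F : IntermediateField K ℂ} {c : ℂ} {k k' : ℤ} {x : ℂ}
    (h : ParityMem F c k x) (hk : Even (k' - k)) : ParityMem F c k' x := by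
  constructor
  · intro he
    exact h.1 (by simpa using he.sub hk)
  · intro ho
    exact h.2 (by simpa using ho.sub_even hk)

theorem ParityMem.of_recurrence {F : IntermediateField K ℂ} {c : ℂ} (hc0 : c ≠ 0) (hc : c ^ 2 ∈ F)
    {s : ℂ} (hs : s ^ 2 ∈ F) {k : ℤ} {ψ : ℤ → ℂ}
    (hψ : ∀ m, ψ (m + 1) + ψ (m - 1) = 2 * ψ m * c / (1 + ψ m ^ 2 * s ^ 2))
    (h0 : ParityMem F c k (ψ 0)) (h1 : ParityMem F c (k + 1) (ψ 1)) (m : ℤ) :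
    ParityMem F c (k + m) (ψ m) := by
  suffices h : ParityMem F c (k + m) (ψ m) ∧ ParityMem F c (k + m + 1) (ψ (m + 1)) from h.1
  induction m using Int.induction_on with
  | zero => simpa using ⟨h0, h1⟩
  | succ i ih =>
    refine ⟨by simpa [add_assoc] using ih.2, ?_⟩
    have h := (ih.1.neg_add hc0 hc hs ih.2 (by simp)).congr (k' := k + (i + 1) + 1) ⟨1, by ring⟩
    rw [← hψ (i + 1)] at h
    simpa using h
  | pred i ih =>
    refine ⟨?_, by simpa [add_assoc] using ih.1⟩
    have h := (ih.2.neg_add hc0 hc hs ih.1 ⟨-1, by ring⟩).congr (k' := k + (-i - 1)) ⟨-1, by ring⟩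
    rw [← hψ (-i)] at h
    simpa using h

theorem parityMem_phi_mul {β : GaussianInt} (hβ : IsOdd β) {δ : ℂ}
    (hδ : (β : ℂ) * δ ∈ periods.lattice) {F : IntermediateField K ℂ} (hF : phi δ ∈ F)
    (α : GaussianInt) : ParityMem F (deriv phi δ) (α.re + α.im) (phi (α * δ)) := by
  have hc0 := deriv_phi_ne_zero hβ hδ
  have hc : deriv phi δ ^ 2 ∈ F := by
    rw [deriv_phi_sq (notMem_poles_of_mul_mem hβ hδ)]
    exact sub_mem (one_mem F) (pow_mem hF 4)
  have hI := I_mem F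
  have tors : ∀ m n : ℤ, (β : ℂ) * ((m + n * I) * δ) ∈ periods.lattice := fun m n => by
    have := mul_mul_mem_lattice ⟨m, n⟩ hδ
    simpa [GaussianInt.toComplex_def] using this
  have hIδ : (β : ℂ) * (I * δ) ∈ periods.lattice := by simpa using tors 0 1
  have hs : phi δ ^ 2 ∈ F := pow_mem hF 2
  have hs' : phi (I * δ) ^ 2 ∈ F := by
    rw [phi_I_mul]
    exact pow_mem (mul_mem hI hF) 2
  have rec1 : ∀ n m : ℤ, phi (((m + 1 : ℤ) + n * I) * δ) + phi (((m - 1 : ℤ) + n * I) * δ) =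
      2 * phi ((m + n * I) * δ) * deriv phi δ / (1 + phi ((m + n * I) * δ) ^ 2 * phi δ ^ 2) := by
    intro n m
    rw [← phi_add_add_phi_sub_of_torsion hβ (tors m n) hδ]
    push_cast
    ring_nf
  have rec2 : ∀ m n : ℤ, phi ((m + (n + 1 : ℤ) * I) * δ) + phi ((m + (n - 1 : ℤ) * I) * δ) =
      2 * phi ((m + n * I) * δ) * deriv phi δ /
        (1 + phi ((m + n * I) * δ) ^ 2 * phi (I * δ) ^ 2) := by
    intro m n
    -- As φ'(iδ) = φ'(δ), the same c governs steps in the direction of i.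
    rw [← deriv_phi_I_mul (notMem_poles_of_mul_mem hβ hδ),
      ← phi_add_add_phi_sub_of_torsion hβ (tors m n) hIδ]
    push_cast
    ring_nf
  have row0 : ∀ m : ℤ, ParityMem F (deriv phi δ) (0 + m) (phi ((m + (0 : ℤ) * I) * δ)) :=
    ParityMem.of_recurrence hc0 hc hs (ψ := fun m => phi ((m + (0 : ℤ) * I) * δ)) (rec1 0)
      (by simp [ParityMem, phi_zero]) (by simpa [ParityMem] using hF)
  have row1 : ∀ m : ℤ, ParityMem F (deriv phi δ) (1 + m) (phi ((m + (1 : ℤ) * I) * δ)) :=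
    ParityMem.of_recurrence hc0 hc hs (ψ := fun m => phi ((m + (1 : ℤ) * I) * δ)) (rec1 1)
      (by simpa [ParityMem, phi_I_mul] using mul_mem hI hF) (by
        have := phi_one_add_I_mul_of_torsion hβ hδ
        refine ⟨fun _ => ?_, fun h => absurd h (by decide)⟩
        simp only [Int.cast_one, one_mul, this]
        exact mul_mem (add_mem (one_mem F) hI) hF)
  -- The rows b = 0 and b = 1 supply the initial values of the column a = `α.re`.
  have := ParityMem.of_recurrence hc0 hc hs' (ψ := fun n => phi ((α.re + n * I) * δ)) (rec2 α.re)
    (by simpa using row0 α.re) (by simpa [add_comm] using row1 α.re) α.im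
  rwa [GaussianInt.toComplex_def]

theorem deriv_phi_mem {β : GaussianInt} (hβ : IsOdd β) {δ : ℂ}
    (hδ : (β : ℂ) * δ ∈ periods.lattice) {F : IntermediateField K ℂ} (hF : phi δ ∈ F) :
    deriv phi δ ∈ F := by
  by_cases hl : δ ∈ periods.lattice
  · rw [deriv_phi_of_mem_lattice hl]
    exact one_mem F
  have h0 : phi δ ≠ 0 := mt (phi_eq_zero_iff_mem_lattice hβ hδ).1 hl
  have h1 := phi_one_add_I_mul_of_torsion hβ hδ
  have h2 : phi ((1 + I) * δ) ∈ F := by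
    -- Adding β makes the multiplier odd, while the period βδ leaves φ unchanged.
    have h := (parityMem_phi_mul hβ hδ hF (⟨1, 1⟩ + β)).2 (by
      have := (even_two (α := ℤ)).add_odd hβ.odd_re_add_im
      simp only [Zsqrtd.re_add, Zsqrtd.im_add]
      convert this using 1
      ring)
    rw [map_add, toComplex_one_add_I, add_mul, phi_add_mem hδ] at h
    exact h
  have h3 : phi ((1 + I) * δ) ≠ 0 := fun h => by
    rw [h, zero_mul] at h1
    exact mul_ne_zero one_add_I_ne_zero h0 h1.symm
  rw [eq_div_of_mul_eq h3 ((mul_comm _ _).trans h1)]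
  exact div_mem (mul_mem (add_mem (one_mem F) (I_mem F)) hF) h2

theorem phi_mul_mem {β : GaussianInt} (hβ : IsOdd β) {δ : ℂ}
    (hδ : (β : ℂ) * δ ∈ periods.lattice) {F : IntermediateField K ℂ} (hF : phi δ ∈ F)
    (α : GaussianInt) : phi (α * δ) ∈ F := by
  have h := parityMem_phi_mul hβ hδ hF α
  rcases Int.even_or_odd (α.re + α.im) with he | ho
  · have h1 := div_mem (h.1 he) (deriv_phi_mem hβ hδ hF)
    rwa [mul_div_cancel_right₀ _ (deriv_phi_ne_zero hβ hδ)] at h1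
  · exact h.2 ho

/-! ### Torsion generators -/

/-- `δ ∈ (1/β) L` such that every element of `(1/β) L` is in `ℤ[i] δ + L`. -/
def Generates (β : GaussianInt) (δ : ℂ) : Prop :=
  (β : ℂ) * δ ∈ periods.lattice ∧
    ∀ z : ℂ, (β : ℂ) * z ∈ periods.lattice → ∃ α : GaussianInt, z - α * δ ∈ periods.lattice

theorem mkQ_mem_torsion {β : GaussianInt} {z : ℂ} :
    (L.mkQ z : E) ∈ torsion β ↔ (β : ℂ) * z ∈ periods.lattice := by
  rw [Submodule.mem_torsionBy_iff, ← map_smul, Submodule.mkQ_apply, Submodule.Quotient.mk_eq_zero]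
  rfl

theorem mkQ_eq_zero {z : ℂ} : (L.mkQ z : E) = 0 ↔ z ∈ periods.lattice := by
  rw [Submodule.mkQ_apply, Submodule.Quotient.mk_eq_zero]
  rfl

theorem IsTorsionGenerator.generates {β : GaussianInt} {δ : ℂ} (h : IsTorsionGenerator β δ) :
    Generates β δ := by
  constructor
  · rw [← mkQ_mem_torsion, ← h]
    exact Submodule.mem_span_singleton_self _
  · intro z hz
    rw [← mkQ_mem_torsion, ← h, Submodule.mem_span_singleton] at hz
    obtain ⟨α, hα⟩ := hz
    refine ⟨α, ?_⟩
    rw [← mkQ_eq_zero, map_sub, ← hα, ← smul_def, map_smul, sub_self]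

theorem generates_two_mul_varpi_div {β : GaussianInt} (hβ : IsOdd β) :
    Generates β (2 * varpi / (β : ℂ)) := by
  have h0 := hβ.toComplex_ne_zero
  constructor
  · rw [mul_div_cancel₀ _ h0]
    refine mem_lattice_iff.2 ⟨2, 0, by simp, by simp⟩
  · intro z hz
    obtain ⟨a, b, hab⟩ := PeriodPair.mem_lattice.1 hz
    obtain ⟨u, v, huv⟩ := hβ
    have huv' := congrArg GaussianInt.toComplex huv
    rw [map_add, map_mul, map_mul, toComplex_one_add_I, map_one] at huv'
    -- With γ = a - bi, βz = (1 + i)ϖγ. Bézout uβ + v(1 + i) = 1 and (1 + i)² = 2i give z = uγ(1 +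
    -- i)ϖ + ivγ·2ϖ/β.
    refine ⟨⟨0, 1⟩ * v * ⟨a, -b⟩, ?_⟩
    have hγ : ((⟨a, -b⟩ : GaussianInt) : ℂ) = a - b * I := by
      simp [GaussianInt.toComplex_def, sub_eq_add_neg]
    have hI : ((⟨0, 1⟩ : GaussianInt) : ℂ) = I := by simp [GaussianInt.toComplex_def]
    have hm := mul_mem_lattice (u * ⟨a, -b⟩) periods.ω₁_mem_lattice
    convert hm using 1
    rw [map_mul, map_mul, map_mul, hγ, hI]
    have hz' : z = ((1 + I) * varpi * (a - b * I)) / β := by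
      rw [eq_div_iff h0, mul_comm, ← hab]
      simp only [periods]
      linear_combination b * varpi * I_sq
    rw [hz']
    simp only [periods]
    field_simp
    linear_combination (-(1 + I) * varpi * (a - b * I)) * huv' +
      varpi * (a - b * I) * (v : ℂ) * I_sq

theorem Generates.phi_mem {β : GaussianInt} (hβ : IsOdd β) {δ : ℂ} (hδ : Generates β δ)
    {F : IntermediateField K ℂ} (hF : phi δ ∈ F) {z : ℂ} (hz : (β : ℂ) * z ∈ periods.lattice) :
    phi z ∈ F := by
  obtain ⟨α, hα⟩ := hδ.2 z hz
  have := phi_add_mem hα (α * δ)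
  rw [add_sub_cancel] at this
  rw [this]
  exact phi_mul_mem hβ hδ.1 hF α

theorem wp_eq {β : GaussianInt} (hβ : IsOdd β) {z : ℂ} (hz : (β : ℂ) * z ∈ periods.lattice)
    (hl : z ∉ periods.lattice) : wp z = (1 + deriv phi z) / (2 * phi z ^ 2) := by
  have h0 : phi z ≠ 0 := mt (phi_eq_zero_iff_mem_lattice hβ hz).1 hl
  rw [one_add_deriv_phi (mt phi_of_mem_zeros h0) (notMem_poles_of_mul_mem hβ hz)]
  field_simp

theorem wp_mem_wp'_mem {β : GaussianInt} (hβ : IsOdd β) {z : ℂ}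
    (hz : (β : ℂ) * z ∈ periods.lattice) (hl : z ∉ periods.lattice) {F : IntermediateField K ℂ}
    (h1 : phi z ∈ F) (h2 : deriv phi z ∈ F) : wp z ∈ F ∧ wp' z ∈ F := by
  have two : (2 : ℂ) ∈ F := ofNat_mem F 2
  have hw : wp z ∈ F := by
    rw [wp_eq hβ hz hl]
    exact div_mem (add_mem (one_mem F) h2) (mul_mem two (pow_mem h1 2))
  refine ⟨hw, ?_⟩
  rw [wp'_eq]
  exact div_mem (mul_mem (neg_mem two) hw) h1

theorem phi_mem_deriv_phi_mem {β : GaussianInt} (hβ : IsOdd β) {z : ℂ}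
    (hz : (β : ℂ) * z ∈ periods.lattice) (hl : z ∉ periods.lattice) {F : IntermediateField K ℂ}
    (h1 : wp z ∈ F) (h2 : wp' z ∈ F) : phi z ∈ F ∧ deriv phi z ∈ F := by
  have two : (2 : ℂ) ∈ F := ofNat_mem F 2
  have h0 : phi z ≠ 0 := mt (phi_eq_zero_iff_mem_lattice hβ hz).1 hl
  have hp := notMem_poles_of_mul_mem hβ hz
  have e1 := one_add_deriv_phi (mt phi_of_mem_zeros h0) hp
  have e2 := wp'_eq z
  -- If ℘(z) = 0 then φ'(z) = -1, so φ(z)⁴ = 0.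
  have hw : wp z ≠ 0 := by
    intro hw
    have e3 := deriv_phi_sq hp
    rw [hw, mul_zero] at e1
    rw [eq_neg_of_add_eq_zero_right e1] at e3
    exact pow_ne_zero 4 h0 (by linear_combination e3)
  have hw' : wp' z ≠ 0 := by
    rw [e2]
    exact div_ne_zero (mul_ne_zero (by norm_num) hw) h0
  have h3 : phi z ∈ F := by
    have : phi z = -2 * wp z / wp' z := by
      rw [eq_div_iff hw', e2]
      field_simp
    rw [this]
    exact div_mem (mul_mem (neg_mem two) h1) h2
  refine ⟨h3, ?_⟩
  rw [eq_sub_of_add_eq' e1]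
  exact sub_mem (mul_mem (mul_mem two (pow_mem h3 2)) h1) (one_mem F)

/-! ### Equality of the generated fields -/

theorem adjoin_pair_le_iff {x y : ℂ} {F : IntermediateField K ℂ} :
    IntermediateField.adjoin K {x, y} ≤ F ↔ x ∈ F ∧ y ∈ F := by
  rw [IntermediateField.adjoin_le_iff, Set.insert_subset_iff, Set.singleton_subset_iff]
  rfl

theorem adjoin_phi_deriv_phi {β : GaussianInt} (hβ : IsOdd β) {δ : ℂ} (hδ : Generates β δ) :
    IntermediateField.adjoin K {phi δ} = IntermediateField.adjoin K {phi δ, deriv phi δ} := by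
  apply le_antisymm
  · exact IntermediateField.adjoin.mono _ _ _ (by simp)
  · have h := IntermediateField.mem_adjoin_simple_self K (phi δ)
    exact adjoin_pair_le_iff.2 ⟨h, deriv_phi_mem hβ hδ.1 h⟩

theorem fieldK_eq {β : GaussianInt} (hβ : IsOdd β) {δ : ℂ} (hδ : Generates β δ) :
    fieldK β = IntermediateField.adjoin K {phi δ} := by
  have hg := generates_two_mul_varpi_div hβ
  apply le_antisymm
  · rw [fieldK, IntermediateField.adjoin_simple_le_iff]
    exact hδ.phi_mem hβ (IntermediateField.mem_adjoin_simple_self K _) hg.1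
  · rw [IntermediateField.adjoin_simple_le_iff]
    exact hg.phi_mem hβ (IntermediateField.mem_adjoin_simple_self K _) hδ.1

theorem adjoin_wp_wp' {β : GaussianInt} (hβ : IsOdd β) {δ : ℂ} (hδ : Generates β δ) :
    IntermediateField.adjoin K {phi δ, deriv phi δ} =
      IntermediateField.adjoin K {wp δ, wp' δ} := by
  -- For δ ∈ L the default values ℘ = ℘' = 0 make the right side K; the left side is K as well,
  -- since φ = 0 and φ' = 1.
  by_cases hl : δ ∈ periods.lattice
  · have h1 : wp δ = 0 := periods.weierstrassP_coe ⟨δ, hl⟩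
    have h2 : wp' δ = 0 := periods.derivWeierstrassP_coe ⟨δ, hl⟩
    rw [h1, h2, (phi_eq_zero_iff_mem_lattice hβ hδ.1).2 hl, deriv_phi_of_mem_lattice hl]
    apply le_antisymm <;> rw [adjoin_pair_le_iff]
    · exact ⟨zero_mem _, one_mem _⟩
    · exact ⟨zero_mem _, zero_mem _⟩
  · apply le_antisymm <;> rw [adjoin_pair_le_iff]
    · obtain ⟨h1, h2⟩ := adjoin_pair_le_iff.1 (le_refl (IntermediateField.adjoin K {wp δ, wp' δ}))
      exact phi_mem_deriv_phi_mem hβ hδ.1 hl h1 h2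
    · obtain ⟨h1, h2⟩ := adjoin_pair_le_iff.1
        (le_refl (IntermediateField.adjoin K {phi δ, deriv phi δ}))
      exact wp_mem_wp'_mem hβ hδ.1 hl h1 h2

theorem adjoin_wp_eq_torsionField {β : GaussianInt} (hβ : IsOdd β) {δ : ℂ} (hδ : Generates β δ) :
    IntermediateField.adjoin K {wp δ, wp' δ} = torsionField β := by
  apply le_antisymm
  · rw [adjoin_pair_le_iff]
    by_cases hl : δ ∈ periods.lattice
    · have h1 : wp δ = 0 := periods.weierstrassP_coe ⟨δ, hl⟩
      have h2 : wp' δ = 0 := periods.derivWeierstrassP_coe ⟨δ, hl⟩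
      rw [h1, h2]
      exact ⟨zero_mem _, zero_mem _⟩
    · have h1 := mt mkQ_eq_zero.1 hl
      have h2 := mkQ_mem_torsion.2 hδ.1
      exact ⟨IntermediateField.subset_adjoin _ _ ⟨δ, h1, h2, Or.inl rfl⟩,
        IntermediateField.subset_adjoin _ _ ⟨δ, h1, h2, Or.inr rfl⟩⟩
  · rw [torsionField, IntermediateField.adjoin_le_iff, ← adjoin_wp_wp' hβ hδ,
      ← adjoin_phi_deriv_phi hβ hδ]
    rintro w ⟨z, hz, ht, hw⟩
    rw [Ne, mkQ_eq_zero] at hz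
    rw [mkQ_mem_torsion] at ht
    have h1 := hδ.phi_mem hβ (IntermediateField.mem_adjoin_simple_self K _) ht
    -- `deriv_phi_mem` needs no generator, so it applies to the torsion point z itself.
    obtain ⟨h2, h3⟩ := wp_mem_wp'_mem hβ ht hz h1 (deriv_phi_mem hβ ht h1)
    rcases hw with rfl | rfl
    exacts [h2, h3]

end Lemniscate

theorem proposition3p1 :
    -- the Weierstrass equation `Y² = 4X³ - g₂X - g₃` of `E = ℂ / L` is `Y² = 4X³ + X`
    (Lemniscate.periods.g₂ = -1 ∧ Lemniscate.periods.g₃ = 0) ∧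
    ∀ (β : GaussianInt) (δ : ℂ), Lemniscate.IsOdd β → Lemniscate.IsTorsionGenerator β δ →
      Lemniscate.fieldK β =
          IntermediateField.adjoin Lemniscate.K {Lemniscate.phi δ} ∧
      IntermediateField.adjoin Lemniscate.K {Lemniscate.phi δ} =
          IntermediateField.adjoin Lemniscate.K {Lemniscate.phi δ, deriv Lemniscate.phi δ} ∧
      IntermediateField.adjoin Lemniscate.K {Lemniscate.phi δ, deriv Lemniscate.phi δ} =
          IntermediateField.adjoin Lemniscate.K {Lemniscate.wp δ, Lemniscate.wp' δ} ∧
      IntermediateField.adjoin Lemniscate.K {Lemniscate.wp δ, Lemniscate.wp' δ} =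
          Lemniscate.torsionField β := by
  refine ⟨⟨Lemniscate.g₂_periods, Lemniscate.g₃_periods⟩, fun β δ hβ h => ?_⟩
  have hδ := h.generates
  exact ⟨Lemniscate.fieldK_eq hβ hδ, Lemniscate.adjoin_phi_deriv_phi hβ hδ,
    Lemniscate.adjoin_wp_wp' hβ hδ, Lemniscate.adjoin_wp_eq_torsionField hβ hδ⟩
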